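/- **Robot.** Let $n\ge 1$. A flexible-joint robot has link and motor positions $q_\ell,q_m\in\mathbb R^n$, momenta $p_\ell,p_m\in\mathbb R^n$, $q=(q_\ell,q_m)$, $p=(p_\ell,p_m)$, $x=(q,p)$, smooth symmetric positive definite inertias $M_\ell(q_\ell),M_m(q_m)$, smooth symmetric positive semidefinite dampings $D_\ell(q_\ell,p_\ell),D_m(q_m,p_m)$, smooth potentials $P_\ell,P_m$ and a constant symmetric positive definite stiffness $K$. Put $M=\mathrm{diag}(M_\ell,M_m)$, $D=\mathrm{diag}(D_\ell,D_m)$, $P(q)=P_\ell(q_\ell)+P_m(q_m)+\tfrac12(q_m-q_\ell)^\top K(q_m-q_\ell)$ and $H=\tfrac12p^\top M^{-1}(q)p+P(q)$. The robot with motor torque $u_m$ is $$\dot q_\ell=\tfrac{\partial H}{\partial p_\ell},\quad \dot q_m=\tfrac{\partial H}{\partial p_m},\quad \dot p_\ell=-\tfrac{\partial H}{\partial q_\ell}-D_\ell\tfrac{\partial H}{\partial p_\ell},\quad \dot p_m=-\tfrac{\partial H}{\partial q_m}-D_m\tfrac{\partial H}{\partial p_m}+u_m .$$ For $k\in\{\ell,m\}$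 let $E_k(q_k,p_k)=S_k-\tfrac12\dot M_k$ with $(S_k)_{ij}=\tfrac12\sum_r(\partial_jM_{k,ir}-\partial_iM_{k,rj})\dot q_{k,r}$ and $\dot q_k=M_k^{-1}p_k$. The virtual system, parametrized by $x$, has state $x_v=(q_{\ell v},q_{mv},p_{\ell v},p_{mv})$, Hamiltonian $H_v=\tfrac12p_v^\top M^{-1}(q)p_v+P(q_v)$ and equations $$\dot q_v=\tfrac{\partial H_v}{\partial p_v},\quad \dot p_{\ell v}=-\tfrac{\partial H_v}{\partial q_{\ell v}}-(E_\ell+D_\ell)\tfrac{\partial H_v}{\partial p_{\ell v}},\quad \dot p_{mv}=-\tfrac{\partial H_v}{\partial q_{mv}}-(E_m+D_m)\tfrac{\partial H_v}{\partial p_{mv}}+u_{mv},$$ where $E_k,D_k$ are evaluated at $x$. Overdots of functions of $(x_v,x,t)$ are total derivatives along the coupled virtual and actual systems. **Controller.** Let $q_{\ell d}$ be a smooth reference, $K_{\ell d},K_{md}$ constant symmetric positive definite matrices, $K_d=\mathrm{diag}(K_{\ell d},K_{md})$, and $\phi_\ell,\phi_m$ smooth maps vanishing at $0$. Define - $\tilde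 q_{\ell v}=q_{\ell v}-q_{\ell d}$, $\ p_{\ell r}=M_\ell(q_\ell)(\dot q_{\ell d}-\phi_\ell(\tilde q_{\ell v}))$, $\ \sigma_{\ell v}=p_{\ell v}-p_{\ell r}$, - $u_{\ell v}=\dot p_{\ell r}+\frac{\partial P_\ell}{\partial q_{\ell v}}(q_{\ell v})+(E_\ell+D_\ell)M_\ell^{-1}p_{\ell r}-\int_0^{\tilde q_{\ell v}}\Pi_\ell(\xi,t)\,d\xi-K_{\ell d}M_\ell^{-1}\sigma_{\ell v}$, - $q_{md}=q_{\ell v}+K^{-1}u_{\ell v}$, $\ \tilde q_{mv}=q_{mv}-q_{md}$, $\ p_{mr}=M_m(q_m)(\dot q_{md}-\phi_m(\tilde q_{mv})+\bar v_{mr})$, $\ \sigma_{mv}=p_{mv}-p_{mr}$, - $u_{mv}=\dot p_{mr}+\frac{\partial P_m}{\partial q_{mv}}(q_{mv})+K(q_{mv}-q_{\ell v})+(E_m+D_m)M_m^{-1}p_{mr}-\int_0^{\tilde q_{mv}}\Pi_m(\xi,t)\,d\xi-K_{md}M_m^{-1}\sigma_{mv}$. Here $\Pi_\ell(z,t),\Pi_m(z,t)$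 are smooth, have conservative rows, and are symmetric positive definite for $t\ge0$, with $\Pi_\ell\ge cI$ for a constant $c>0$. With functions $\beta_\ell,\beta_m$ that are bounded below by a positive constant they satisfy, for $k\in\{\ell,m\}$ and all $x_v$, $x$, $t\ge 0$, $$\dot\Pi_k-\Pi_k\tfrac{\partial\phi_k}{\partial\tilde q_{kv}}-\tfrac{\partial\phi_k}{\partial\tilde q_{kv}}^{\!\top}\Pi_k\le-2\beta_k\Pi_k\quad\text{at }(\tilde q_{kv},t),$$ where $\dot\Pi_k$ is the total derivative of $\Pi_k(\tilde q_{kv},t)$. The smooth function $\bar v_{mr}(x_v,x,t)$ satisfies $\delta\bar v_{mr}=-\Pi_m^{-1}(\tilde q_{mv},t)K^\top M_\ell^{-\top}(q_\ell)\,\delta\sigma_{\ell v}$ for all variations $\delta x_v$ ($x$, $t\ge0$ fixed), and vanishes when $\tilde q_{\ell v}=\tilde q_{mv}=\sigma_{\ell v}=0$. **Claim.** Apply $u_m(x,t)=u_{mv}(x,x,t)$ to the robot. Put $\beta_{\tilde q}(\tilde q_v,t)=\min\{\beta_\ell(\tilde q_{\ell v},t),\beta_m(\tilde q_{mv},t)\}$,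 $$\beta(\tilde q_v,x,t)=2\min\{\beta_{\tilde q}(\tilde q_v,t),\ \lambda_{\min}(D(x)+K_d)\,\lambda_{\min}(M^{-1}(q))\},$$ and let $W(t)=\frac12(\tilde q_\ell^\top\Pi_\ell\tilde q_\ell+\tilde q_m^\top\Pi_m\tilde q_m+\sigma^\top M^{-1}(q)\sigma)$ be the storage function of the error at $x_v=x(t)$, where $\sigma=(\sigma_\ell,\sigma_m)$. Then: 1. For all $t_0\ge0$ and $x_0$ there is a closed-loop solution on $[t_0,\infty)$ with $x(t_0)=x_0$. 2. For every closed-loop solution on $[t_0,T]$, $t_0\ge 0$, and every continuous $b$ with $b(s)\le\beta(\theta\tilde q(s),x(s),s)$ for all $s\in[t_0,T]$, $\theta\in[0,1]$, $$c\,|q_\ell(T)-q_{\ell d}(T)|^2\le 2W(t_0)\,e^{-\int_{t_0}^{T}b(s)\,ds}.$$ 3. If $M_\ell$ and $M_m$ are bounded, then $\beta\ge b$ everywhere (for $t\ge0$) for some constant $b>0$, and $c\,|q_\ell(t)-q_{\ell d}(t)|^2\le 2W(t_0)e^{-b(t-t_0)}$ for all $t\ge t_0\ge0$ and all closed-loop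 solutions on $[t_0,\infty)$. That is, the convergence is global and exponential, and $\beta$ is the rate for the squared error. -/

import Mathlib

open scoped Matrix ContDiff

noncomputable section

namespace FJR

/-- Coordinate space `ℝⁿ` (link positions, motor positions, link momenta, motor momenta). -/
abbrev V (n : ℕ) := Fin n → ℝ

/-- State `x = (q_ℓ, q_m, p_ℓ, p_m)` of a robot with `n` flexible joints. -/
abbrev State (n : ℕ) := V n × V n × V n × V n

def State.ql {n : ℕ} (x : State n) : V n := x.1
def State.qm {n : ℕ} (x : State n) : V n := x.2.1
def State.pl {n : ℕ} (x : State n) : V n := x.2.2.1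
def State.pm {n : ℕ} (x : State n) : V n := x.2.2.2

/-- Gradient (vector of partial derivatives). -/
def grad {n : ℕ} (f : V n → ℝ) (q : V n) : V n :=
  fun i => fderiv ℝ f q (Pi.single i 1)

/-- Jacobian matrix. -/
def jacobian {n : ℕ} (φ : V n → V n) (z : V n) : Matrix (Fin n) (Fin n) ℝ :=
  Matrix.of fun i j => fderiv ℝ φ z (Pi.single j 1) i

/-- `Ṁ(q)` when `q̇ = w`: the entrywise derivative of `M` at `q` in the direction `w`. -/
def inertiaRate {n : ℕ} (M : V n → Matrix (Fin n) (Fin n) ℝ) (q w : V n) :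
    Matrix (Fin n) (Fin n) ℝ :=
  Matrix.of fun i j => fderiv ℝ (fun q => M q i j) q w

/-- The skew-symmetric matrix
`S_{kj}(q, w) = ½ ∑ᵢ (∂M_{ki}/∂q_j - ∂M_{ij}/∂q_k) wᵢ`. -/
def skewPart {n : ℕ} (M : V n → Matrix (Fin n) (Fin n) ℝ) (q w : V n) :
    Matrix (Fin n) (Fin n) ℝ :=
  Matrix.of fun k j => (1 / 2 : ℝ) * ∑ i,
    (fderiv ℝ (fun q => M q k i) q (Pi.single j 1)
      - fderiv ℝ (fun q => M q i j) q (Pi.single k 1)) * w i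

/-- The workless-force matrix `E(q, p) = S(q, q̇) - ½ Ṁ(q)` with `q̇ = M(q)⁻¹ p`. -/
def workless {n : ℕ} (M : V n → Matrix (Fin n) (Fin n) ℝ) (q p : V n) :
    Matrix (Fin n) (Fin n) ℝ :=
  skewPart M q ((M q)⁻¹ *ᵥ p) - (1 / 2 : ℝ) • inertiaRate M q ((M q)⁻¹ *ᵥ p)

/-- The least eigenvalue of a symmetric matrix. -/
def lambdaMin {ι : Type*} [Fintype ι] [DecidableEq ι] (A : Matrix ι ι ℝ) : ℝ :=
  sInf (spectrum ℝ A)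

/-- `∫₀ᶻ A(ξ, t) dξ`, along the segment from `0` to `z` (for a matrix field with conservative rows
the path does not matter). -/
def lineIntegral {n : ℕ} (A : V n → ℝ → Matrix (Fin n) (Fin n) ℝ) (z : V n) (t : ℝ) : V n :=
  ∫ s in (0 : ℝ)..1, A (s • z) t *ᵥ z

/-- A robot with `n` flexible joints: link and motor inertia matrices, damping matrices and
potential energies, and the stiffness matrix of the (linear) joint springs. -/
structure Robot (n : ℕ) where
  Ml : V n → Matrix (Fin n) (Fin n) ℝ
  Mm : V n → Matrix (Fin n) (Fin n) ℝ
  Dl : V n → V n → Matrix (Fin n) (Fin n) ℝ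
  Dm : V n → V n → Matrix (Fin n) (Fin n) ℝ
  Pl : V n → ℝ
  Pm : V n → ℝ
  K : Matrix (Fin n) (Fin n) ℝ
  Ml_smooth : ∀ i j, ContDiff ℝ ∞ (fun q => Ml q i j)
  Mm_smooth : ∀ i j, ContDiff ℝ ∞ (fun q => Mm q i j)
  Dl_smooth : ∀ i j, ContDiff ℝ ∞ (fun y : V n × V n => Dl y.1 y.2 i j)
  Dm_smooth : ∀ i j, ContDiff ℝ ∞ (fun y : V n × V n => Dm y.1 y.2 i j)
  Pl_smooth : ContDiff ℝ ∞ Pl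
  Pm_smooth : ContDiff ℝ ∞ Pm
  Ml_posDef : ∀ q, (Ml q).PosDef
  Mm_posDef : ∀ q, (Mm q).PosDef
  Dl_posSemidef : ∀ q p, (Dl q p).PosSemidef
  Dm_posSemidef : ∀ q p, (Dm q p).PosSemidef
  K_posDef : K.PosDef

variable {n : ℕ}

namespace Robot

/-- Potential energy `P(q) = P_ℓ(q_ℓ) + P_m(q_m) + ½ ζᵀ K ζ`, `ζ = q_m - q_ℓ`. -/
def potential (R : Robot n) (ql qm : V n) : ℝ :=
  R.Pl ql + R.Pm qm + (1 / 2 : ℝ) * ((qm - ql) ⬝ᵥ R.K *ᵥ (qm - ql))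

/-- The Hamiltonian `H(q, p) = ½ pᵀ M(q)⁻¹ p + P(q)`, `M = diag(M_ℓ, M_m)`. -/
def hamiltonian (R : Robot n) (ql qm pl pm : V n) : ℝ :=
  (1 / 2 : ℝ) * (pl ⬝ᵥ (R.Ml ql)⁻¹ *ᵥ pl) + (1 / 2 : ℝ) * (pm ⬝ᵥ (R.Mm qm)⁻¹ *ᵥ pm)
    + R.potential ql qm

/-- The port-Hamiltonian robot `ẋ = field x u` with motor torque `u`. -/
def field (R : Robot n) (x : State n) (u : V n) : State n :=
  let Hql := grad (fun q => R.hamiltonian q x.qm x.pl x.pm) x.ql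
  let Hqm := grad (fun q => R.hamiltonian x.ql q x.pl x.pm) x.qm
  let Hpl := grad (fun p => R.hamiltonian x.ql x.qm p x.pm) x.pl
  let Hpm := grad (fun p => R.hamiltonian x.ql x.qm x.pl p) x.pm
  (Hpl, Hpm, -Hql - R.Dl x.ql x.pl *ᵥ Hpl, -Hqm - R.Dm x.qm x.pm *ᵥ Hpm + u)

/-- The virtual Hamiltonian `H_v(x_v, x) = ½ p_vᵀ M(q)⁻¹ p_v + P(q_v)`; the inertia is evaluated
at the actual position `q`. -/
def virtualHamiltonian (R : Robot n) (x : State n) (qlv qmv plv pmv : V n) : ℝ :=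
  (1 / 2 : ℝ) * (plv ⬝ᵥ (R.Ml x.ql)⁻¹ *ᵥ plv) + (1 / 2 : ℝ) * (pmv ⬝ᵥ (R.Mm x.qm)⁻¹ *ᵥ pmv)
    + R.potential qlv qmv

/-- `E_ℓ(x_ℓ) + D_ℓ(x_ℓ)`. -/
def EDl (R : Robot n) (x : State n) : Matrix (Fin n) (Fin n) ℝ :=
  workless R.Ml x.ql x.pl + R.Dl x.ql x.pl

/-- `E_m(x_m) + D_m(x_m)`. -/
def EDm (R : Robot n) (x : State n) : Matrix (Fin n) (Fin n) ℝ :=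
  workless R.Mm x.qm x.pm + R.Dm x.qm x.pm

/-- The virtual control system `ẋ_v = virtualField x_v x u_v`, parametrized by the state `x` of the
actual robot. -/
def virtualField (R : Robot n) (xv x : State n) (uv : V n) : State n :=
  let Hql := grad (fun q => R.virtualHamiltonian x q xv.qm xv.pl xv.pm) xv.ql
  let Hqm := grad (fun q => R.virtualHamiltonian x xv.ql q xv.pl xv.pm) xv.qm
  let Hpl := grad (fun p => R.virtualHamiltonian x xv.ql xv.qm p xv.pm) xv.pl
  let Hpm := grad (fun p => R.virtualHamiltonian x xv.ql xv.qm xv.pl p) xv.pm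
  (Hpl, Hpm, -Hql - R.EDl x *ᵥ Hpl, -Hqm - R.EDm x *ᵥ Hpm + uv)

/-- The overdot: time derivative of `F(x_v(t), x(t), t)` along the coupled virtual and actual
systems. Inputs enter only the equations of `p_mv` and `p_m`; every quantity that is differentiated
below is independent of `p_mv` and `p_m`, so the inputs do not matter and are set to `0`. -/
def dot (R : Robot n) {G : Type*} [NormedAddCommGroup G] [NormedSpace ℝ G]
    (F : State n → State n → ℝ → G) (xv x : State n) (t : ℝ) : G :=
  fderiv ℝ (fun y : State n × State n × ℝ => F y.1 y.2.1 y.2.2) (xv, x, t)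
    (R.virtualField xv x 0, R.field x 0, 1)

end Robot

/-- The reference link trajectory `q_ℓd` and the design parameters of the controller: the maps
`φ_ℓ, φ_m`, the metrics `Π_ℓ, Π_m`, the contraction rates `β_ℓ, β_m`, the derivative gains and the
coupling velocity `v̄_mr(x_v, x, t)`. -/
structure Design (n : ℕ) where
  qd : ℝ → V n
  φl : V n → V n
  φm : V n → V n
  metl : V n → ℝ → Matrix (Fin n) (Fin n) ℝ
  metm : V n → ℝ → Matrix (Fin n) (Fin n) ℝ
  βl : V n → ℝ → ℝ
  βm : V n → ℝ → ℝ
  Kld : Matrix (Fin n) (Fin n) ℝ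
  Kmd : Matrix (Fin n) (Fin n) ℝ
  vbar : State n → State n → ℝ → V n

namespace Design

/-- `q̃_ℓv = q_ℓv - q_ℓd(t)`. -/
def errQl (C : Design n) (xv : State n) (t : ℝ) : V n := xv.ql - C.qd t

/-- `p_ℓr = M_ℓ(q_ℓ) (q̇_ℓd - φ_ℓ(q̃_ℓv))`. -/
def plr (R : Robot n) (C : Design n) (xv x : State n) (t : ℝ) : V n :=
  R.Ml x.ql *ᵥ (deriv C.qd t - C.φl (C.errQl xv t))

/-- `σ_ℓv = p_ℓv - p_ℓr`. -/
def sigmaL (R : Robot n) (C : Design n) (xv x : State n) (t : ℝ) : V n :=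
  xv.pl - C.plr R xv x t

/-- The link control law `u_ℓv` (with zero external input). -/
def ul (R : Robot n) (C : Design n) (xv x : State n) (t : ℝ) : V n :=
  (R.dot (C.plr R) xv x t + grad R.Pl xv.ql + R.EDl x *ᵥ ((R.Ml x.ql)⁻¹ *ᵥ C.plr R xv x t))
    + (-lineIntegral C.metl (C.errQl xv t) t - C.Kld *ᵥ ((R.Ml x.ql)⁻¹ *ᵥ C.sigmaL R xv x t))

/-- The motor position reference `q_md = q_ℓv + K⁻¹ u_ℓv`. -/
def qmd (R : Robot n) (C : Design n) (xv x : State n) (t : ℝ) : V n :=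
  xv.ql + R.K⁻¹ *ᵥ C.ul R xv x t

/-- `q̃_mv = q_mv - q_md`. -/
def errQm (R : Robot n) (C : Design n) (xv x : State n) (t : ℝ) : V n :=
  xv.qm - C.qmd R xv x t

/-- `p_mr = M_m(q_m) (q̇_md - φ_m(q̃_mv) + v̄_mr)`. -/
def pmr (R : Robot n) (C : Design n) (xv x : State n) (t : ℝ) : V n :=
  R.Mm x.qm *ᵥ (R.dot (C.qmd R) xv x t - C.φm (C.errQm R xv x t) + C.vbar xv x t)

/-- `σ_mv = p_mv - p_mr`. -/
def sigmaM (R : Robot n) (C : Design n) (xv x : State n) (t : ℝ) : V n :=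
  xv.pm - C.pmr R xv x t

/-- The virtual control law `u_mv(x_v, x, t)` (with zero external input). -/
def umv (R : Robot n) (C : Design n) (xv x : State n) (t : ℝ) : V n :=
  (R.dot (C.pmr R) xv x t + grad R.Pm xv.qm + R.K *ᵥ (xv.qm - xv.ql)
      + R.EDm x *ᵥ ((R.Mm x.qm)⁻¹ *ᵥ C.pmr R xv x t))
    + (-lineIntegral C.metm (C.errQm R xv x t) t
      - C.Kmd *ᵥ ((R.Mm x.qm)⁻¹ *ᵥ C.sigmaM R xv x t))

/-- The control applied to the robot: `u_m(x, t) = u_mv(x, x, t)`. -/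
def um (R : Robot n) (C : Design n) (x : State n) (t : ℝ) : V n := C.umv R x x t

/-- `x` solves the closed-loop system `ẋ = field x (u_m(x, t))` on the time set `s`. -/
def IsClosedLoopSolution (R : Robot n) (C : Design n) (x : ℝ → State n) (s : Set ℝ) : Prop :=
  ∀ t ∈ s, HasDerivWithinAt x (R.field (x t) (C.um R (x t) t)) s t

/-- The derivative along the virtual dynamics of a metric evaluated at an error `z(x_v, x, t)`. -/
def metricRate (R : Robot n) (A : V n → ℝ → Matrix (Fin n) (Fin n) ℝ)
    (z : State n → State n → ℝ → V n) (xv x : State n) (t : ℝ) : Matrix (Fin n) (Fin n) ℝ :=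
  Matrix.of fun i j => R.dot (fun xv x t => A (z xv x t) t i j) xv x t

/-- `Π̇(z, t) - Π(z, t) ∂φ(z) - ∂φ(z)ᵀ Π(z, t) ≤ -2 β(z, t) Π(z, t)` at `z = z(x_v, x, t)`, for all
`x_v`, `x` and `t ≥ 0`. -/
def ContractionInequality (R : Robot n) (A : V n → ℝ → Matrix (Fin n) (Fin n) ℝ)
    (φ : V n → V n) (β : V n → ℝ → ℝ) (z : State n → State n → ℝ → V n) : Prop :=
  ∀ xv x t, 0 ≤ t →
    ((-(2 * β (z xv x t) t)) • A (z xv x t) t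
      - (metricRate R A z xv x t - A (z xv x t) t * jacobian φ (z xv x t)
        - (jacobian φ (z xv x t))ᵀ * A (z xv x t) t)).PosSemidef

/-- The rows of `A(·, t)` are conservative vector fields: `A(·, t)` is the Jacobian of a map. -/
def ConservativeRows (A : V n → ℝ → Matrix (Fin n) (Fin n) ℝ) : Prop :=
  ∀ t, 0 ≤ t → ∃ g : V n → V n, Differentiable ℝ g ∧ ∀ z, jacobian g z = A z t

/-- The standing assumptions on the reference and on the design parameters. -/
structure Admissible (R : Robot n) (C : Design n) : Prop where
  qd_smooth : ContDiff ℝ ∞ C.qd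
  φl_smooth : ContDiff ℝ ∞ C.φl
  φm_smooth : ContDiff ℝ ∞ C.φm
  metl_smooth : ∀ i j, ContDiff ℝ ∞ (fun y : V n × ℝ => C.metl y.1 y.2 i j)
  metm_smooth : ∀ i j, ContDiff ℝ ∞ (fun y : V n × ℝ => C.metm y.1 y.2 i j)
  vbar_smooth : ContDiff ℝ ∞ (fun y : State n × State n × ℝ => C.vbar y.1 y.2.1 y.2.2)
  φl_zero : C.φl 0 = 0
  φm_zero : C.φm 0 = 0
  Kld_posDef : C.Kld.PosDef
  Kmd_posDef : C.Kmd.PosDef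
  metl_posDef : ∀ z t, 0 ≤ t → (C.metl z t).PosDef
  metm_posDef : ∀ z t, 0 ≤ t → (C.metm z t).PosDef
  metl_conservative : ConservativeRows C.metl
  metm_conservative : ConservativeRows C.metm
  βl_pos : ∃ ε > 0, ∀ z t, 0 ≤ t → ε ≤ C.βl z t
  βm_pos : ∃ ε > 0, ∀ z t, 0 ≤ t → ε ≤ C.βm z t
  contraction_l : ContractionInequality R C.metl C.φl C.βl (fun xv _ t => C.errQl xv t)
  contraction_m : ContractionInequality R C.metm C.φm C.βm (C.errQm R)
  /-- `δv̄_mr = -Π_m⁻¹(q̃_mv, t) Kᵀ M_ℓ⁻ᵀ(q_ℓ) δσ_ℓv` for all variations `δx_v`. -/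
  vbar_variation : ∀ xv x t, 0 ≤ t → ∀ δ : State n,
    fderiv ℝ (fun y => C.vbar y x t) xv δ =
      -((C.metm (C.errQm R xv x t) t)⁻¹ *ᵥ (R.Kᵀ *ᵥ (((R.Ml x.ql)⁻¹)ᵀ *ᵥ
        fderiv ℝ (fun y => C.sigmaL R y x t) xv δ)))
  /-- `v̄_mr` vanishes at zero error, so that the zero error is a solution of the closed loop. -/
  vbar_zero : ∀ xv x t, 0 ≤ t → C.errQl xv t = 0 → C.errQm R xv x t = 0 →
    C.sigmaL R xv x t = 0 → C.vbar xv x t = 0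

/-- `λ_min(D(x) + K_d) λ_min(M(q)⁻¹)` for `D = diag(D_ℓ, D_m)`, `K_d = diag(K_ℓd, K_md)` and
`M = diag(M_ℓ, M_m)`. -/
def momentumRate (R : Robot n) (C : Design n) (x : State n) : ℝ :=
  lambdaMin (Matrix.fromBlocks (R.Dl x.ql x.pl) 0 0 (R.Dm x.qm x.pm)
      + Matrix.fromBlocks C.Kld 0 0 C.Kmd)
    * lambdaMin (Matrix.fromBlocks (R.Ml x.ql) 0 0 (R.Mm x.qm))⁻¹

/-- The rate `β = 2 min {β_q̃(q̃_v, t), λ_min(D(x) + K_d) λ_min(M(q)⁻¹)}`, where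
`β_q̃(q̃_v, t) = min {β_ℓ(q̃_ℓv, t), β_m(q̃_mv, t)}` at `q̃_v = (zl, zm)`. -/
def rate (R : Robot n) (C : Design n) (zl zm : V n) (x : State n) (t : ℝ) : ℝ :=
  2 * min (min (C.βl zl t) (C.βm zm t)) (C.momentumRate R x)

/-- The storage function `W = ½ (q̃ᵀ diag(Π_ℓ, Π_m) q̃ + σᵀ M(q)⁻¹ σ)` of the error of the actual
robot (`x_v = x`). -/
def storage (R : Robot n) (C : Design n) (x : State n) (t : ℝ) : ℝ :=
  (1 / 2 : ℝ) *
    (C.errQl x t ⬝ᵥ C.metl (C.errQl x t) t *ᵥ C.errQl x t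
      + C.errQm R x x t ⬝ᵥ C.metm (C.errQm R x x t) t *ᵥ C.errQm R x x t
      + C.sigmaL R x x t ⬝ᵥ (R.Ml x.ql)⁻¹ *ᵥ C.sigmaL R x x t
      + C.sigmaM R x x t ⬝ᵥ (R.Mm x.qm)⁻¹ *ᵥ C.sigmaM R x x t)

end Design

end FJR

end

/-!
The contraction inequalities are imposed for all virtual and actual states, while the error velocity
`d/dt q̃_kv` takes every value at a given error: the momentum `p_kv` enters it, but not the error.
The total derivative of `Π_k` is affine in this velocity and bounded above as a quadratic form, so
its linear part vanishes and `Π_k(z, t) = Π_k(0, t)` for `t ≥ 0` (`metric_eq_zero_position`).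
Consequently `∫₀ᶻ Π_k(ξ, t) dξ = Π_k(0, t) z`, and the variational equation of `v̄_mr` integrates to
`v̄_mr = -Π_m⁻¹ K M_ℓ⁻¹ σ_ℓv` (`vbar_eq`); in particular no quantity whose total derivative enters
the controller sees the motor momenta.

At `x_v = x` the virtual system is the robot, because `E(q, p) M⁻¹ p` is the gradient of the kinetic
energy (`workless_mulVec_velocity`, `field_eq_virtualField`). With `v = M⁻¹ σ` the closed loop
becomes

* `d/dt q̃_ℓ = v_ℓ - φ_ℓ(q̃_ℓ)`,
* `d/dt σ_ℓ = K q̃_m - (E_ℓ + D_ℓ + K_ℓd) v_ℓ - Π_ℓ q̃_ℓ`,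
* `d/dt q̃_m = v_m - φ_m(q̃_m) - Π_m⁻¹ K v_ℓ`,
* `d/dt σ_m = -(E_m + D_m + K_md) v_m - Π_m q̃_m`.

In the derivative of the storage function `W` the coupling terms cancel, and `vᵀ E v = -½ vᵀ Ṁ v`
compensates the derivative of `M⁻¹`. The contraction inequality, integrated along the rays from `0`
to the errors (`ray_inequality`), and the dissipation estimate `momentumRate_mul_le` then give
`Ẇ ≤ -b W` (`hasDerivAt_storage`), whence the bounds on the link error.

For the existence of solutions, the closed-loop field is smooth and `W` does not increase. On
compact time intervals `W` controls the state (`exists_norm_le_of_storage_le`), so that solutions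
are bounded a priori. The field, cut off outside a large ball, is then integrated by the
Picard–Lindelöf theorem, and the solutions on growing intervals are glued by uniqueness.
-/

noncomputable section

namespace FJR

open Set MeasureTheory Filter Topology Metric

/-! ### Smoothness of integrals, matrix products and inverses -/

/-- Differentiation under the integral sign: the derivative of `F` is bounded on the compact product
of a ball around `x₀` and the interval. -/
theorem hasFDerivAt_intervalIntegral_of_contDiff {H E : Type} [NormedAddCommGroup H]
    [NormedSpace ℝ H] [FiniteDimensional ℝ H] [NormedAddCommGroup E] [NormedSpace ℝ E]
    {F : H × ℝ → E} (hF : ContDiff ℝ 1 F) (x₀ : H) :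
    HasFDerivAt (fun x => ∫ s in (0 : ℝ)..1, F (x, s))
      (∫ s in (0 : ℝ)..1, (fderiv ℝ F (x₀, s)).comp (ContinuousLinearMap.inl ℝ H ℝ)) x₀ := by
  have hc : Continuous fun y : H × ℝ =>
      (fderiv ℝ F y).comp (ContinuousLinearMap.inl ℝ H ℝ) :=
    (hF.continuous_fderiv one_ne_zero).clm_comp continuous_const
  have hK : IsCompact (closedBall x₀ 1 ×ˢ Icc (0 : ℝ) 1) :=
    (isCompact_closedBall x₀ 1).prod isCompact_Icc
  obtain ⟨B, hB⟩ := hK.exists_bound_of_continuousOn hc.continuousOn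
  refine intervalIntegral.hasFDerivAt_integral_of_dominated_of_fderiv_le (bound := fun _ => B)
    (F' := fun x s => (fderiv ℝ F (x, s)).comp (ContinuousLinearMap.inl ℝ H ℝ))
    (closedBall_mem_nhds x₀ one_pos) ?_ ?_ ?_ ?_ ?_ ?_
  · exact Eventually.of_forall fun x =>
      (hF.continuous.comp (by fun_prop : Continuous fun s : ℝ => (x, s))).aestronglyMeasurable
  · exact (hF.continuous.comp
      (by fun_prop : Continuous fun s : ℝ => (x₀, s))).intervalIntegrable _ _
  · exact (hc.comp (by fun_prop : Continuous fun s : ℝ => (x₀, s))).aestronglyMeasurable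
  · refine Eventually.of_forall fun s hs x hx => hB (x, s) ⟨hx, ?_⟩
    rw [uIoc_of_le zero_le_one] at hs
    exact ⟨hs.1.le, hs.2⟩
  · exact intervalIntegrable_const
  · refine Eventually.of_forall fun s _ x _ => ?_
    have h1 := (hF.differentiable one_ne_zero (x, s)).hasFDerivAt
    exact h1.comp x (hasFDerivAt_prodMk_left x s)

/-- Induction on the order of smoothness: the derivative is again an integral of a smooth map, with
values in another space. -/
theorem contDiff_nat_intervalIntegral {H : Type} [NormedAddCommGroup H]
    [NormedSpace ℝ H] [FiniteDimensional ℝ H] (k : ℕ) :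
    ∀ {E : Type} [NormedAddCommGroup E] [NormedSpace ℝ E] {F : H × ℝ → E},
      ContDiff ℝ ∞ F → ContDiff ℝ k (fun x => ∫ s in (0 : ℝ)..1, F (x, s)) := by
  induction k with
  | zero =>
    intro E _ _ F hF
    exact contDiff_zero.2 (intervalIntegral.continuous_parametric_intervalIntegral_of_continuous'
      (f := fun x s => F (x, s)) hF.continuous 0 1)
  | succ k ih =>
    intro E _ _ F hF
    have hd := hasFDerivAt_intervalIntegral_of_contDiff (hF.of_le (by exact_mod_cast le_top))
    rw [Nat.cast_succ, contDiff_succ_iff_fderiv]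
    refine ⟨fun x => (hd x).differentiableAt, by simp, ?_⟩
    rw [funext fun x => (hd x).fderiv]
    exact ih (F := fun y => (fderiv ℝ F y).comp (ContinuousLinearMap.inl ℝ H ℝ))
      ((contDiff_infty_iff_fderiv.1 hF).2.clm_comp contDiff_const)

theorem contDiff_intervalIntegral {H E : Type} [NormedAddCommGroup H]
    [NormedSpace ℝ H] [FiniteDimensional ℝ H] [NormedAddCommGroup E] [NormedSpace ℝ E]
    {F : H × ℝ → E} (hF : ContDiff ℝ ∞ F) :
    ContDiff ℝ ∞ (fun x => ∫ s in (0 : ℝ)..1, F (x, s)) :=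
  contDiff_infty.2 fun k => contDiff_nat_intervalIntegral k hF

section Entries

variable {n : ℕ} {X : Type} [NormedAddCommGroup X] [NormedSpace ℝ X]

theorem contDiff_mulVec {A : X → Matrix (Fin n) (Fin n) ℝ} {v : X → V n}
    (hA : ∀ i j, ContDiff ℝ ∞ fun x => A x i j) (hv : ContDiff ℝ ∞ v) :
    ContDiff ℝ ∞ fun x => A x *ᵥ v x := by
  rw [contDiff_pi]
  intro i
  simp only [Matrix.mulVec, dotProduct]
  exact ContDiff.sum fun j _ => (hA i j).mul (contDiff_pi.1 hv j)

theorem contDiff_dotProduct {v w : X → V n} (hv : ContDiff ℝ ∞ v) (hw : ContDiff ℝ ∞ w) :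
    ContDiff ℝ ∞ fun x => v x ⬝ᵥ w x := by
  simp only [dotProduct]
  exact ContDiff.sum fun j _ => (contDiff_pi.1 hv j).mul (contDiff_pi.1 hw j)

theorem contDiff_det {A : X → Matrix (Fin n) (Fin n) ℝ}
    (hA : ∀ i j, ContDiff ℝ ∞ fun x => A x i j) : ContDiff ℝ ∞ fun x => (A x).det := by
  simp only [Matrix.det_apply']
  exact ContDiff.sum fun σ _ => contDiff_const.mul (contDiff_prod fun i _ => hA _ _)

theorem contDiff_inv_entry {A : X → Matrix (Fin n) (Fin n) ℝ}
    (hA : ∀ i j, ContDiff ℝ ∞ fun x => A x i j) (hpos : ∀ x, (A x).PosDef) (i j : Fin n) :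
    ContDiff ℝ ∞ fun x => (A x)⁻¹ i j := by
  simp only [Matrix.inv_def, Ring.inverse_eq_inv', Matrix.smul_apply, smul_eq_mul]
  refine ((contDiff_det hA).inv fun x => (hpos x).det_pos.ne').mul ?_
  simp only [Matrix.adjugate_apply]
  refine contDiff_det fun k l => ?_
  by_cases hk : k = j
  · subst hk
    simpa using contDiff_const
  · simpa [Matrix.updateRow_ne hk] using hA k l

theorem contDiff_grad {f : V n → ℝ} (hf : ContDiff ℝ ∞ f) : ContDiff ℝ ∞ (grad f) := by
  rw [contDiff_pi]
  intro i
  exact (contDiff_infty_iff_fderiv.1 hf).2.clm_apply contDiff_const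

theorem contDiff_fderiv_apply {Y G : Type} [NormedAddCommGroup Y] [NormedSpace ℝ Y]
    [NormedAddCommGroup G] [NormedSpace ℝ G]
    {F : Y → G} (hF : ContDiff ℝ ∞ F) {g h : X → Y} (hg : ContDiff ℝ ∞ g)
    (hh : ContDiff ℝ ∞ h) : ContDiff ℝ ∞ fun x => fderiv ℝ F (g x) (h x) :=
  ((contDiff_infty_iff_fderiv.1 hF).2.comp hg).clm_apply hh

theorem contDiff_inertiaRate_entry {M : V n → Matrix (Fin n) (Fin n) ℝ}
    (hM : ∀ i j, ContDiff ℝ ∞ fun q => M q i j) {q w : X → V n} (hq : ContDiff ℝ ∞ q)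
    (hw : ContDiff ℝ ∞ w) (i j : Fin n) :
    ContDiff ℝ ∞ fun x => inertiaRate M (q x) (w x) i j :=
  contDiff_fderiv_apply (hM i j) hq hw

theorem contDiff_skewPart_entry {M : V n → Matrix (Fin n) (Fin n) ℝ}
    (hM : ∀ i j, ContDiff ℝ ∞ fun q => M q i j) {q w : X → V n} (hq : ContDiff ℝ ∞ q)
    (hw : ContDiff ℝ ∞ w) (i j : Fin n) :
    ContDiff ℝ ∞ fun x => skewPart M (q x) (w x) i j := by
  simp only [skewPart, Matrix.of_apply]
  refine contDiff_const.mul (ContDiff.sum fun k _ => ?_)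
  exact ((contDiff_fderiv_apply (hM _ _) hq contDiff_const).sub
    (contDiff_fderiv_apply (hM _ _) hq contDiff_const)).mul (contDiff_pi.1 hw k)

theorem contDiff_workless_entry {M : V n → Matrix (Fin n) (Fin n) ℝ}
    (hM : ∀ i j, ContDiff ℝ ∞ fun q => M q i j) (hpos : ∀ q, (M q).PosDef) {q p : X → V n}
    (hq : ContDiff ℝ ∞ q) (hp : ContDiff ℝ ∞ p) (i j : Fin n) :
    ContDiff ℝ ∞ fun x => workless M (q x) (p x) i j := by
  have hw : ContDiff ℝ ∞ fun x => (M (q x))⁻¹ *ᵥ p x :=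
    contDiff_mulVec (contDiff_inv_entry (fun i j => (hM i j).comp hq) fun x => hpos _) hp
  simp only [workless, Matrix.sub_apply, Matrix.smul_apply, smul_eq_mul]
  exact (contDiff_skewPart_entry hM hq hw i j).sub
    (contDiff_const.mul (contDiff_inertiaRate_entry hM hq hw i j))

theorem contDiff_lineIntegral {A : V n → ℝ → Matrix (Fin n) (Fin n) ℝ}
    (hA : ∀ i j, ContDiff ℝ ∞ fun y : V n × ℝ => A y.1 y.2 i j) {z : X → V n} {t : X → ℝ}
    (hz : ContDiff ℝ ∞ z) (ht : ContDiff ℝ ∞ t) :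
    ContDiff ℝ ∞ fun x => lineIntegral A (z x) (t x) := by
  have key : ContDiff ℝ ∞ fun y : V n × ℝ =>
      ∫ s in (0 : ℝ)..1, A (s • y.1) y.2 *ᵥ y.1 := by
    refine contDiff_intervalIntegral
      (F := fun w : (V n × ℝ) × ℝ => A (w.2 • w.1.1) w.1.2 *ᵥ w.1.1) ?_
    exact contDiff_mulVec (fun i j => (hA i j).comp
      (by fun_prop : ContDiff ℝ ∞ fun w : (V n × ℝ) × ℝ => (w.2 • w.1.1, w.1.2)))
      (by fun_prop)
  exact key.comp (hz.prodMk ht)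

end Entries

/-! ### Symmetric and positive definite matrices -/

section Symmetric

theorem dotProduct_mulVec_symm {ι : Type*} [Fintype ι] {A : Matrix ι ι ℝ} (hA : Aᵀ = A)
    (v w : ι → ℝ) :
    v ⬝ᵥ A *ᵥ w = w ⬝ᵥ A *ᵥ v := by
  rw [Matrix.dotProduct_mulVec, ← Matrix.mulVec_transpose, hA, dotProduct_comm]

theorem transpose_eq_of_posDef {ι : Type*} {A : Matrix ι ι ℝ} (hA : A.PosDef) : Aᵀ = A := by
  simpa [Matrix.conjTranspose_eq_transpose_of_trivial] using hA.isHermitian.eq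

variable {ι : Type*} [Fintype ι] [DecidableEq ι]

theorem transpose_inv_of_posDef {A : Matrix ι ι ℝ} (hA : A.PosDef) :
    (A⁻¹)ᵀ = A⁻¹ := transpose_eq_of_posDef hA.inv

theorem mulVec_inv_mulVec {A : Matrix ι ι ℝ} (hA : A.PosDef) (v : ι → ℝ) :
    A *ᵥ (A⁻¹ *ᵥ v) = v := by
  rw [Matrix.mulVec_mulVec, Matrix.mul_nonsing_inv _ hA.det_pos.ne'.isUnit, Matrix.one_mulVec]

theorem inv_mulVec_mulVec {A : Matrix ι ι ℝ} (hA : A.PosDef) (v : ι → ℝ) :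
    A⁻¹ *ᵥ (A *ᵥ v) = v := by
  rw [Matrix.mulVec_mulVec, Matrix.nonsing_inv_mul _ hA.det_pos.ne'.isUnit, Matrix.one_mulVec]

end Symmetric

/-! ### Derivatives of matrix expressions along curves -/

section Curves

variable {n : ℕ}

theorem hasDerivAt_mulVec {A : ℝ → Matrix (Fin n) (Fin n) ℝ} {A' : Matrix (Fin n) (Fin n) ℝ}
    {v : ℝ → V n} {v' : V n} {t : ℝ} (hA : ∀ i j, HasDerivAt (fun s => A s i j) (A' i j) t)
    (hv : HasDerivAt v v' t) :
    HasDerivAt (fun s => A s *ᵥ v s) (A' *ᵥ v t + A t *ᵥ v') t := by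
  rw [hasDerivAt_pi]
  intro i
  simp only [Matrix.mulVec, dotProduct, Pi.add_apply, ← Finset.sum_add_distrib]
  exact HasDerivAt.fun_sum fun j _ => (hA i j).mul (hasDerivAt_pi.1 hv j)

theorem hasDerivAt_dotProduct {v w : ℝ → V n} {v' w' : V n} {t : ℝ}
    (hv : HasDerivAt v v' t) (hw : HasDerivAt w w' t) :
    HasDerivAt (fun s => v s ⬝ᵥ w s) (v' ⬝ᵥ w t + v t ⬝ᵥ w') t := by
  simp only [dotProduct, ← Finset.sum_add_distrib]
  exact HasDerivAt.fun_sum fun j _ => (hasDerivAt_pi.1 hv j).mul (hasDerivAt_pi.1 hw j)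

theorem hasDerivAt_line (q v : V n) : HasDerivAt (fun s : ℝ => q + s • v) v 0 := by
  simpa using ((hasDerivAt_id (0 : ℝ)).smul_const v).const_add q

theorem hasDerivAt_comp_line {E : Type*} [NormedAddCommGroup E] [NormedSpace ℝ E] {f : V n → E}
    {q : V n} (hf : DifferentiableAt ℝ f q) (v : V n) :
    HasDerivAt (fun s : ℝ => f (q + s • v)) (fderiv ℝ f q v) 0 := by
  have h : HasFDerivAt f (fderiv ℝ f q) (q + (0 : ℝ) • v) := by simpa using hf.hasFDerivAt
  exact h.comp_hasDerivAt (0 : ℝ) (hasDerivAt_line q v)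

theorem contDiff_quadratic (A : Matrix (Fin n) (Fin n) ℝ) :
    ContDiff ℝ ∞ fun p : V n => (1 / 2 : ℝ) * (p ⬝ᵥ A *ᵥ p) :=
  contDiff_const.mul
    (contDiff_dotProduct contDiff_id (contDiff_mulVec (fun _ _ => contDiff_const) contDiff_id))

theorem grad_quadratic {A : Matrix (Fin n) (Fin n) ℝ} (hA : Aᵀ = A) (p : V n) :
    grad (fun p => (1 / 2 : ℝ) * (p ⬝ᵥ A *ᵥ p)) p = A *ᵥ p := by
  funext i
  have h1 := hasDerivAt_comp_line
    ((contDiff_quadratic A).differentiable (by simp) p) (Pi.single i 1)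
  have hl := hasDerivAt_line p (Pi.single i 1)
  have h2 := (hasDerivAt_dotProduct hl
    (hasDerivAt_mulVec (A := fun _ => A) (A' := 0)
      (fun i j => by simpa using hasDerivAt_const (0 : ℝ) (A i j)) hl)).const_mul (1 / 2 : ℝ)
  have h3 := h1.unique h2
  simp only [grad, h3, zero_smul, add_zero]
  have h4 : p ⬝ᵥ A *ᵥ (Pi.single i 1) = (A *ᵥ p) i := by
    rw [dotProduct_mulVec_symm hA]; simp
  simp only [Matrix.zero_mulVec, zero_add, h4, single_dotProduct]
  ring

theorem grad_add {f g : V n → ℝ} {q : V n} (hf : DifferentiableAt ℝ f q)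
    (hg : DifferentiableAt ℝ g q) : grad (fun q => f q + g q) q = grad f q + grad g q := by
  funext i
  simp [grad, fderiv_fun_add hf hg]

theorem grad_const (c : ℝ) (q : V n) : grad (fun _ => c) q = 0 := by
  funext i
  simp [grad]

theorem grad_comp_sub_left {f : V n → ℝ} (hf : Differentiable ℝ f) (a q : V n) :
    grad (fun q => f (a - q)) q = -grad f (a - q) := by
  funext i
  have h := (hf (a - q)).hasFDerivAt.comp q ((hasFDerivAt_id q).const_sub a)
  have h1 : fderiv ℝ (fun q => f (a - q)) q = _ := h.fderiv
  simp [grad, h1]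

theorem grad_comp_sub_right {f : V n → ℝ} (hf : Differentiable ℝ f) (a q : V n) :
    grad (fun q => f (q - a)) q = grad f (q - a) := by
  funext i
  have h := (hf (q - a)).hasFDerivAt.comp q ((hasFDerivAt_id q).sub_const a)
  have h1 : fderiv ℝ (fun q => f (q - a)) q = _ := h.fderiv
  simp [grad, h1]

end Curves

/-! ### The inertia matrices -/

section Inertia

variable {n : ℕ} {M : V n → Matrix (Fin n) (Fin n) ℝ}

theorem fderiv_apply_eq_sum {f : V n → ℝ} (q w : V n) :
    fderiv ℝ f q w = ∑ i, w i * fderiv ℝ f q (Pi.single i 1) := by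
  conv_lhs => rw [pi_eq_sum_univ' w, map_sum]
  simp [map_smul]

/-- The defining property of the workless-force matrix: `E(q, p) M⁻¹ p` is the force
`∂/∂q (½ pᵀ M(q)⁻¹ p) = -½ wᵀ (∂M/∂q) w`, `w = M⁻¹ p`. -/
theorem workless_mulVec_velocity (q p : V n) (k : Fin n) :
    (workless M q p *ᵥ ((M q)⁻¹ *ᵥ p)) k =
      -(1 / 2 : ℝ) * (((M q)⁻¹ *ᵥ p) ⬝ᵥ
        inertiaRate M q (Pi.single k 1) *ᵥ ((M q)⁻¹ *ᵥ p)) := by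
  unfold workless
  generalize (M q)⁻¹ *ᵥ p = w
  rw [Matrix.sub_mulVec, Matrix.smul_mulVec, Pi.sub_apply, Pi.smul_apply, smul_eq_mul]
  have h1 : (skewPart M q w *ᵥ w) k = ∑ j, ∑ i, (1 / 2 : ℝ) *
      (fderiv ℝ (fun q => M q k i) q (Pi.single j 1)
        - fderiv ℝ (fun q => M q i j) q (Pi.single k 1)) * w i * w j := by
    simp only [skewPart, Matrix.mulVec, dotProduct, Matrix.of_apply, Finset.mul_sum,
      Finset.sum_mul, mul_assoc]
  have h2 : (inertiaRate M q w *ᵥ w) k = ∑ j, ∑ i,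
      fderiv ℝ (fun q => M q k i) q (Pi.single j 1) * w i * w j := by
    simp only [inertiaRate, Matrix.mulVec, dotProduct, Matrix.of_apply]
    rw [Finset.sum_comm]
    refine Finset.sum_congr rfl fun i _ => ?_
    rw [fderiv_apply_eq_sum q w, Finset.sum_mul]
    exact Finset.sum_congr rfl fun j _ => by ring
  have h3 : w ⬝ᵥ inertiaRate M q (Pi.single k 1) *ᵥ w = ∑ j, ∑ i,
      fderiv ℝ (fun q => M q i j) q (Pi.single k 1) * w i * w j := by
    simp only [inertiaRate, Matrix.mulVec, dotProduct, Matrix.of_apply, Finset.mul_sum]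
    rw [Finset.sum_comm]
    exact Finset.sum_congr rfl fun i _ => Finset.sum_congr rfl fun j _ => by ring
  rw [h1, h2, h3]
  simp only [Finset.mul_sum, ← Finset.sum_sub_distrib]
  exact Finset.sum_congr rfl fun i _ => Finset.sum_congr rfl fun j _ => by ring

theorem skewPart_quadratic (hM : ∀ q, (M q)ᵀ = M q) (q w v : V n) :
    v ⬝ᵥ skewPart M q w *ᵥ v = 0 := by
  have hs : ∀ i j, (fun q => M q i j) = fun q => M q j i := fun i j =>
    funext fun q => congrFun (congrFun (hM q) j) i
  have h : (skewPart M q w)ᵀ = -skewPart M q w := by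
    ext k j
    simp only [skewPart, Matrix.transpose_apply, Matrix.of_apply, Matrix.neg_apply]
    rw [← mul_neg, ← Finset.sum_neg_distrib]
    congr 1
    refine Finset.sum_congr rfl fun i _ => ?_
    rw [hs i k, hs j i]
    ring
  have h1 : v ⬝ᵥ skewPart M q w *ᵥ v = -(v ⬝ᵥ skewPart M q w *ᵥ v) := by
    conv_lhs => rw [Matrix.dotProduct_mulVec, ← Matrix.mulVec_transpose, h, dotProduct_comm]
    simp [Matrix.neg_mulVec]
  linarith

theorem workless_quadratic (hM : ∀ q, (M q)ᵀ = M q) (q p v : V n) :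
    v ⬝ᵥ workless M q p *ᵥ v =
      -(1 / 2 : ℝ) * (v ⬝ᵥ inertiaRate M q ((M q)⁻¹ *ᵥ p) *ᵥ v) := by
  simp only [workless, Matrix.sub_mulVec, dotProduct_sub, skewPart_quadratic hM,
    Matrix.smul_mulVec, dotProduct_smul, smul_eq_mul]
  ring

/-- The derivative of `σᵀ M⁻¹ σ` along a curve in terms of `v = M⁻¹ σ`. Differentiating `M v = σ`
avoids the derivative of the inverse matrix. -/
theorem hasDerivAt_kinetic (hM : ∀ i j, ContDiff ℝ ∞ fun q => M q i j)
    (hpos : ∀ q, (M q).PosDef) {q σ : ℝ → V n} {q' σ' : V n} {t : ℝ}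
    (hq : HasDerivAt q q' t) (hσ : HasDerivAt σ σ' t) :
    HasDerivAt (fun s => σ s ⬝ᵥ (M (q s))⁻¹ *ᵥ σ s)
      (2 * (((M (q t))⁻¹ *ᵥ σ t) ⬝ᵥ σ')
        - ((M (q t))⁻¹ *ᵥ σ t) ⬝ᵥ inertiaRate M (q t) q' *ᵥ ((M (q t))⁻¹ *ᵥ σ t)) t := by
  have hinv : ∀ i j, HasDerivAt (fun s => (M (q s))⁻¹ i j)
      (fderiv ℝ (fun q => (M q)⁻¹ i j) (q t) q') t := fun i j =>
    (((contDiff_inv_entry hM hpos i j).differentiable (by simp) (q t)).hasFDerivAt).comp_hasDerivAt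
      t hq
  have hMd : ∀ i j, HasDerivAt (fun s => M (q s) i j) (inertiaRate M (q t) q' i j) t :=
    fun i j =>
    (((hM i j).differentiable (by simp) (q t)).hasFDerivAt).comp_hasDerivAt t hq
  have hv := hasDerivAt_mulVec (A := fun s => (M (q s))⁻¹)
    (A' := Matrix.of fun i j => fderiv ℝ (fun q => (M q)⁻¹ i j) (q t) q') hinv hσ
  set v' := (Matrix.of fun i j => fderiv ℝ (fun q => (M q)⁻¹ i j) (q t) q') *ᵥ σ t
    + (M (q t))⁻¹ *ᵥ σ'
  set v := (M (q t))⁻¹ *ᵥ σ t with hvdef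
  -- differentiate `M v = σ`
  have h1 := hasDerivAt_mulVec hMd hv
  simp only [mulVec_inv_mulVec (hpos _)] at h1
  have h2 : σ' = inertiaRate M (q t) q' *ᵥ v + M (q t) *ᵥ v' := hσ.unique h1
  convert hasDerivAt_dotProduct hσ hv using 1
  have h3 : σ t ⬝ᵥ v' = v ⬝ᵥ M (q t) *ᵥ v' := by
    rw [dotProduct_mulVec_symm (transpose_eq_of_posDef (hpos _)), hvdef,
      mulVec_inv_mulVec (hpos _), dotProduct_comm]
  have h4 : v ⬝ᵥ σ' = v ⬝ᵥ inertiaRate M (q t) q' *ᵥ v + v ⬝ᵥ M (q t) *ᵥ v' := by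
    rw [h2, dotProduct_add]
  rw [← hvdef, h3, dotProduct_comm σ' v]
  linarith

theorem grad_kinetic (hM : ∀ i j, ContDiff ℝ ∞ fun q => M q i j)
    (hpos : ∀ q, (M q).PosDef) (q p : V n) :
    DifferentiableAt ℝ (fun q => (1 / 2 : ℝ) * (p ⬝ᵥ (M q)⁻¹ *ᵥ p)) q ∧
      grad (fun q => (1 / 2 : ℝ) * (p ⬝ᵥ (M q)⁻¹ *ᵥ p)) q =
        workless M q p *ᵥ ((M q)⁻¹ *ᵥ p) := by
  have hd : DifferentiableAt ℝ (fun q => (1 / 2 : ℝ) * (p ⬝ᵥ (M q)⁻¹ *ᵥ p)) q := by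
    have : ContDiff ℝ ∞ (fun q => (1 / 2 : ℝ) * (p ⬝ᵥ (M q)⁻¹ *ᵥ p)) :=
      contDiff_const.mul (contDiff_dotProduct contDiff_const
        (contDiff_mulVec (contDiff_inv_entry hM hpos) contDiff_const))
    exact this.differentiable (by simp) q
  refine ⟨hd, ?_⟩
  funext k
  rw [workless_mulVec_velocity]
  have h1 := hasDerivAt_comp_line hd (Pi.single k 1)
  have h2 := (hasDerivAt_kinetic hM hpos (hasDerivAt_line q (Pi.single k 1))
    (hasDerivAt_const (0 : ℝ) p)).const_mul (1 / 2 : ℝ)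
  have h3 := h1.unique h2
  simp only [grad, h3, zero_smul, add_zero, dotProduct_zero]
  ring

end Inertia

/-! ### The robot and its virtual system in explicit form -/

namespace Robot

variable {n : ℕ} (R : Robot n)

theorem Ml_symm (q : V n) : (R.Ml q)ᵀ = R.Ml q := transpose_eq_of_posDef (R.Ml_posDef q)

theorem Mm_symm (q : V n) : (R.Mm q)ᵀ = R.Mm q := transpose_eq_of_posDef (R.Mm_posDef q)

theorem K_symm : R.Kᵀ = R.K := transpose_eq_of_posDef R.K_posDef

theorem grad_potential_link (ql qm : V n) :
    (Differentiable ℝ fun q => R.potential q qm) ∧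
    grad (fun q => R.potential q qm) ql = grad R.Pl ql - R.K *ᵥ (qm - ql) := by
  have h1 : Differentiable ℝ fun q => R.Pl q + R.Pm qm :=
    (R.Pl_smooth.differentiable (by simp)).add_const _
  have h2 : Differentiable ℝ fun q => (1 / 2 : ℝ) * ((qm - q) ⬝ᵥ R.K *ᵥ (qm - q)) :=
    ((contDiff_quadratic R.K).comp (by fun_prop : ContDiff ℝ ∞ fun q => qm - q)).differentiable
      (by simp)
  refine ⟨h1.add h2, ?_⟩
  unfold potential
  rw [grad_add (h1 ql) (h2 ql), grad_add (R.Pl_smooth.differentiable (by simp) ql) (by fun_prop),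
    grad_const, grad_comp_sub_left (f := fun z => (1 / 2 : ℝ) * (z ⬝ᵥ R.K *ᵥ z))
      ((contDiff_quadratic _).differentiable (by simp)),
    grad_quadratic R.K_symm]
  abel

theorem grad_potential_motor (ql qm : V n) :
    (Differentiable ℝ fun q => R.potential ql q) ∧
    grad (fun q => R.potential ql q) qm = grad R.Pm qm + R.K *ᵥ (qm - ql) := by
  have h1 : Differentiable ℝ fun q => R.Pl ql + R.Pm q :=
    (R.Pm_smooth.differentiable (by simp)).const_add _
  have h2 : Differentiable ℝ fun q => (1 / 2 : ℝ) * ((q - ql) ⬝ᵥ R.K *ᵥ (q - ql)) :=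
    ((contDiff_quadratic R.K).comp (by fun_prop : ContDiff ℝ ∞ fun q => q - ql)).differentiable
      (by simp)
  refine ⟨h1.add h2, ?_⟩
  unfold potential
  rw [grad_add (h1 qm) (h2 qm), grad_add (by fun_prop) (R.Pm_smooth.differentiable (by simp) qm),
    grad_const, grad_comp_sub_right (f := fun z => (1 / 2 : ℝ) * (z ⬝ᵥ R.K *ᵥ z))
      ((contDiff_quadratic _).differentiable (by simp)),
    grad_quadratic R.K_symm]
  abel

theorem virtualField_eq (xv x : State n) (u : V n) :
    R.virtualField xv x u =
      ((R.Ml x.ql)⁻¹ *ᵥ xv.pl, (R.Mm x.qm)⁻¹ *ᵥ xv.pm,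
        -(grad R.Pl xv.ql - R.K *ᵥ (xv.qm - xv.ql)) - R.EDl x *ᵥ ((R.Ml x.ql)⁻¹ *ᵥ xv.pl),
        -(grad R.Pm xv.qm + R.K *ᵥ (xv.qm - xv.ql)) - R.EDm x *ᵥ ((R.Mm x.qm)⁻¹ *ᵥ xv.pm)
          + u) := by
  have hd : ∀ A : Matrix (Fin n) (Fin n) ℝ, Differentiable ℝ
      fun p : V n => (1 / 2 : ℝ) * (p ⬝ᵥ A *ᵥ p) := fun A =>
    (contDiff_quadratic A).differentiable (by simp)
  have h1 : grad (fun p => R.virtualHamiltonian x xv.ql xv.qm p xv.pm) xv.pl =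
      (R.Ml x.ql)⁻¹ *ᵥ xv.pl := by
    unfold virtualHamiltonian
    rw [grad_add ((hd _).add_const _ _) (by fun_prop), grad_add (hd _ _) (by fun_prop),
      grad_const, grad_const, grad_quadratic (transpose_inv_of_posDef (R.Ml_posDef _))]
    simp
  have h2 : grad (fun p => R.virtualHamiltonian x xv.ql xv.qm xv.pl p) xv.pm =
      (R.Mm x.qm)⁻¹ *ᵥ xv.pm := by
    unfold virtualHamiltonian
    rw [grad_add ((hd _).const_add _ _) (by fun_prop), grad_add (by fun_prop) (hd _ _),
      grad_const, grad_const, grad_quadratic (transpose_inv_of_posDef (R.Mm_posDef _))]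
    simp
  have h3 : grad (fun q => R.virtualHamiltonian x q xv.qm xv.pl xv.pm) xv.ql =
      grad R.Pl xv.ql - R.K *ᵥ (xv.qm - xv.ql) := by
    unfold virtualHamiltonian
    rw [grad_add (by fun_prop) ((R.grad_potential_link xv.ql xv.qm).1 _), grad_const,
      (R.grad_potential_link _ _).2, zero_add]
  have h4 : grad (fun q => R.virtualHamiltonian x xv.ql q xv.pl xv.pm) xv.qm =
      grad R.Pm xv.qm + R.K *ᵥ (xv.qm - xv.ql) := by
    unfold virtualHamiltonian
    rw [grad_add (by fun_prop) ((R.grad_potential_motor xv.ql xv.qm).1 _), grad_const,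
      (R.grad_potential_motor _ _).2, zero_add]
  simp only [virtualField, h1, h2, h3, h4]

/-- The actual robot is the virtual system at `x_v = x`: the workless force replaces the derivative
of the kinetic energy with respect to the position. -/
theorem field_eq_virtualField (x : State n) (u : V n) :
    R.field x u = R.virtualField x x u := by
  have hd : ∀ A : Matrix (Fin n) (Fin n) ℝ, Differentiable ℝ
      fun p : V n => (1 / 2 : ℝ) * (p ⬝ᵥ A *ᵥ p) := fun A =>
    (contDiff_quadratic A).differentiable (by simp)
  have h1 : grad (fun p => R.hamiltonian x.ql x.qm p x.pm) x.pl = (R.Ml x.ql)⁻¹ *ᵥ x.pl := by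
    unfold hamiltonian
    rw [grad_add ((hd _).add_const _ _) (by fun_prop), grad_add (hd _ _) (by fun_prop),
      grad_const, grad_const, grad_quadratic (transpose_inv_of_posDef (R.Ml_posDef _))]
    simp
  have h2 : grad (fun p => R.hamiltonian x.ql x.qm x.pl p) x.pm = (R.Mm x.qm)⁻¹ *ᵥ x.pm := by
    unfold hamiltonian
    rw [grad_add ((hd _).const_add _ _) (by fun_prop), grad_add (by fun_prop) (hd _ _),
      grad_const, grad_const, grad_quadratic (transpose_inv_of_posDef (R.Mm_posDef _))]
    simp
  have kl := grad_kinetic R.Ml_smooth R.Ml_posDef x.ql x.pl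
  have km := grad_kinetic R.Mm_smooth R.Mm_posDef x.qm x.pm
  have h3 : grad (fun q => R.hamiltonian q x.qm x.pl x.pm) x.ql =
      workless R.Ml x.ql x.pl *ᵥ ((R.Ml x.ql)⁻¹ *ᵥ x.pl)
        + (grad R.Pl x.ql - R.K *ᵥ (x.qm - x.ql)) := by
    unfold hamiltonian
    rw [grad_add (kl.1.add_const _) ((R.grad_potential_link x.ql x.qm).1 _),
      grad_add kl.1 (by fun_prop), grad_const, (R.grad_potential_link _ _).2, kl.2, add_zero]
  have h4 : grad (fun q => R.hamiltonian x.ql q x.pl x.pm) x.qm =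
      workless R.Mm x.qm x.pm *ᵥ ((R.Mm x.qm)⁻¹ *ᵥ x.pm)
        + (grad R.Pm x.qm + R.K *ᵥ (x.qm - x.ql)) := by
    unfold hamiltonian
    rw [grad_add (km.1.const_add _) ((R.grad_potential_motor x.ql x.qm).1 _),
      grad_add (by fun_prop) km.1, grad_const, (R.grad_potential_motor _ _).2, km.2, zero_add]
  rw [virtualField_eq]
  simp only [field, h1, h2, h3, h4, EDl, EDm, Matrix.add_mulVec]
  refine Prod.ext rfl (Prod.ext rfl (Prod.ext ?_ ?_)) <;> simp only <;> abel

end Robot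

/-! ### Smoothness of the closed loop -/

section Coordinates

variable {n : ℕ} {X : Type} [NormedAddCommGroup X] [NormedSpace ℝ X] {f : X → State n}

theorem contDiff_ql (hf : ContDiff ℝ ∞ f) : ContDiff ℝ ∞ fun x => (f x).ql :=
  contDiff_fst.comp hf

theorem contDiff_qm (hf : ContDiff ℝ ∞ f) : ContDiff ℝ ∞ fun x => (f x).qm :=
  contDiff_fst.comp (contDiff_snd.comp hf)

theorem contDiff_pl (hf : ContDiff ℝ ∞ f) : ContDiff ℝ ∞ fun x => (f x).pl :=
  contDiff_fst.comp (contDiff_snd.comp (contDiff_snd.comp hf))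

theorem contDiff_pm (hf : ContDiff ℝ ∞ f) : ContDiff ℝ ∞ fun x => (f x).pm :=
  contDiff_snd.comp (contDiff_snd.comp (contDiff_snd.comp hf))

end Coordinates

/-- Joint smoothness of a function of the virtual state, the actual state and time. -/
def SmoothIn {n : ℕ} {G : Type} [NormedAddCommGroup G] [NormedSpace ℝ G]
    (F : State n → State n → ℝ → G) : Prop :=
  ContDiff ℝ ∞ fun y : State n × State n × ℝ => F y.1 y.2.1 y.2.2

namespace Robot

variable {n : ℕ} (R : Robot n)

theorem contDiff_Ml_inv (i j : Fin n) : ContDiff ℝ ∞ fun q => (R.Ml q)⁻¹ i j :=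
  contDiff_inv_entry R.Ml_smooth R.Ml_posDef i j

theorem contDiff_Mm_inv (i j : Fin n) : ContDiff ℝ ∞ fun q => (R.Mm q)⁻¹ i j :=
  contDiff_inv_entry R.Mm_smooth R.Mm_posDef i j

section

variable {X : Type} [NormedAddCommGroup X] [NormedSpace ℝ X]

theorem contDiff_EDl_entry {x : X → State n} (hx : ContDiff ℝ ∞ x) (i j : Fin n) :
    ContDiff ℝ ∞ fun y => R.EDl (x y) i j := by
  simp only [EDl, Matrix.add_apply]
  exact (contDiff_workless_entry R.Ml_smooth R.Ml_posDef (contDiff_ql hx) (contDiff_pl hx) i j).add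
    ((R.Dl_smooth i j).comp ((contDiff_ql hx).prodMk (contDiff_pl hx)))

theorem contDiff_EDm_entry {x : X → State n} (hx : ContDiff ℝ ∞ x) (i j : Fin n) :
    ContDiff ℝ ∞ fun y => R.EDm (x y) i j := by
  simp only [EDm, Matrix.add_apply]
  exact (contDiff_workless_entry R.Mm_smooth R.Mm_posDef (contDiff_qm hx) (contDiff_pm hx) i j).add
    ((R.Dm_smooth i j).comp ((contDiff_qm hx).prodMk (contDiff_pm hx)))

theorem contDiff_virtualField {xv x : X → State n} {u : X → V n} (hv : ContDiff ℝ ∞ xv)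
    (hx : ContDiff ℝ ∞ x) (hu : ContDiff ℝ ∞ u) :
    ContDiff ℝ ∞ fun y => R.virtualField (xv y) (x y) (u y) := by
  simp only [virtualField_eq]
  have h1 : ContDiff ℝ ∞ fun y => (R.Ml (x y).ql)⁻¹ *ᵥ (xv y).pl :=
    contDiff_mulVec (fun i j => (R.contDiff_Ml_inv i j).comp (contDiff_ql hx)) (contDiff_pl hv)
  have h2 : ContDiff ℝ ∞ fun y => (R.Mm (x y).qm)⁻¹ *ᵥ (xv y).pm :=
    contDiff_mulVec (fun i j => (R.contDiff_Mm_inv i j).comp (contDiff_qm hx)) (contDiff_pm hv)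
  have h3 : ContDiff ℝ ∞ fun y => R.K *ᵥ ((xv y).qm - (xv y).ql) :=
    contDiff_mulVec (fun _ _ => contDiff_const) ((contDiff_qm hv).sub (contDiff_ql hv))
  refine h1.prodMk (h2.prodMk (ContDiff.prodMk ?_ ?_))
  · exact ((((contDiff_grad R.Pl_smooth).comp (contDiff_ql hv)).sub h3).neg).sub
      (contDiff_mulVec (R.contDiff_EDl_entry hx) h1)
  · exact (((((contDiff_grad R.Pm_smooth).comp (contDiff_qm hv)).add h3).neg).sub
      (contDiff_mulVec (R.contDiff_EDm_entry hx) h2)).add hu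

end

variable {R} in
theorem smoothIn_dot {G : Type} [NormedAddCommGroup G] [NormedSpace ℝ G]
    {F : State n → State n → ℝ → G} (hF : SmoothIn F) : SmoothIn (R.dot F) := by
  refine contDiff_fderiv_apply hF contDiff_id ?_
  simp only [field_eq_virtualField]
  exact (R.contDiff_virtualField contDiff_fst (contDiff_fst.comp contDiff_snd)
    contDiff_const).prodMk ((R.contDiff_virtualField (contDiff_fst.comp contDiff_snd)
      (contDiff_fst.comp contDiff_snd) contDiff_const).prodMk contDiff_const)

end Robot

namespace Design.Admissible

variable {n : ℕ} {R : Robot n} {C : Design n} (hC : C.Admissible R)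

theorem contDiff_xv : ContDiff ℝ ∞ fun y : State n × State n × ℝ => y.1 := contDiff_fst

theorem contDiff_x : ContDiff ℝ ∞ fun y : State n × State n × ℝ => y.2.1 :=
  contDiff_fst.comp contDiff_snd

theorem contDiff_t : ContDiff ℝ ∞ fun y : State n × State n × ℝ => y.2.2 :=
  contDiff_snd.comp contDiff_snd

include hC

theorem smooth_errQl : SmoothIn fun (xv _ : State n) t => C.errQl xv t :=
  (contDiff_ql contDiff_xv).sub (hC.qd_smooth.comp contDiff_t)

theorem smooth_plr : SmoothIn (C.plr R) := by
  refine contDiff_mulVec (fun i j => (R.Ml_smooth i j).comp (contDiff_ql contDiff_x)) ?_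
  exact ((contDiff_infty_iff_deriv.1 hC.qd_smooth).2.comp contDiff_t).sub
    (hC.φl_smooth.comp hC.smooth_errQl)

theorem smooth_sigmaL : SmoothIn (C.sigmaL R) := (contDiff_pl contDiff_xv).sub hC.smooth_plr

theorem smooth_ul : SmoothIn (C.ul R) := by
  have hi : ∀ i j, ContDiff ℝ ∞ fun y : State n × State n × ℝ => (R.Ml y.2.1.ql)⁻¹ i j :=
    fun i j => (R.contDiff_Ml_inv i j).comp (contDiff_ql contDiff_x)
  exact (((R.smoothIn_dot hC.smooth_plr).add
    ((contDiff_grad R.Pl_smooth).comp (contDiff_ql contDiff_xv))).add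
    (contDiff_mulVec (R.contDiff_EDl_entry contDiff_x) (contDiff_mulVec hi hC.smooth_plr))).add
    ((contDiff_lineIntegral hC.metl_smooth hC.smooth_errQl contDiff_t).neg.sub
      (contDiff_mulVec (fun _ _ => contDiff_const) (contDiff_mulVec hi hC.smooth_sigmaL)))

theorem smooth_qmd : SmoothIn (C.qmd R) :=
  (contDiff_ql contDiff_xv).add (contDiff_mulVec (fun _ _ => contDiff_const) hC.smooth_ul)

theorem smooth_errQm : SmoothIn (C.errQm R) := (contDiff_qm contDiff_xv).sub hC.smooth_qmd

theorem smooth_pmr : SmoothIn (C.pmr R) := by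
  refine contDiff_mulVec (fun i j => (R.Mm_smooth i j).comp (contDiff_qm contDiff_x)) ?_
  exact ((R.smoothIn_dot hC.smooth_qmd).sub (hC.φm_smooth.comp hC.smooth_errQm)).add
    hC.vbar_smooth

theorem smooth_sigmaM : SmoothIn (C.sigmaM R) := (contDiff_pm contDiff_xv).sub hC.smooth_pmr

theorem smooth_umv : SmoothIn (C.umv R) := by
  have hi : ∀ i j, ContDiff ℝ ∞ fun y : State n × State n × ℝ => (R.Mm y.2.1.qm)⁻¹ i j :=
    fun i j => (R.contDiff_Mm_inv i j).comp (contDiff_qm contDiff_x)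
  exact ((((R.smoothIn_dot hC.smooth_pmr).add
    ((contDiff_grad R.Pm_smooth).comp (contDiff_qm contDiff_xv))).add
    (contDiff_mulVec (A := fun _ => R.K) (fun _ _ => contDiff_const)
      ((contDiff_qm contDiff_xv).sub (contDiff_ql contDiff_xv)))).add
    (contDiff_mulVec (R.contDiff_EDm_entry contDiff_x) (contDiff_mulVec hi hC.smooth_pmr))).add
    ((contDiff_lineIntegral hC.metm_smooth hC.smooth_errQm contDiff_t).neg.sub
      (contDiff_mulVec (A := fun _ => C.Kmd) (fun _ _ => contDiff_const)
        (contDiff_mulVec hi hC.smooth_sigmaM)))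

theorem contDiff_closedLoop :
    ContDiff ℝ ∞ fun y : ℝ × State n => R.field y.2 (C.um R y.2 y.1) := by
  simp only [Robot.field_eq_virtualField]
  refine R.contDiff_virtualField contDiff_snd contDiff_snd ?_
  exact hC.smooth_umv.comp
    (contDiff_snd.prodMk (contDiff_snd.prodMk contDiff_fst) :
      ContDiff ℝ ∞ fun y : ℝ × State n => (y.2, y.2, y.1))

end Design.Admissible

/-! ### Total derivatives and the variables they see -/

section Projections

variable {n : ℕ}

/-- The projection `(q_ℓ, q_m, p_ℓ, p_m) ↦ (q_ℓ, 0, 0, 0)`. -/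
def linkPosition : State n →L[ℝ] State n :=
  (ContinuousLinearMap.fst ℝ _ _).prod 0

/-- The projection `(q_ℓ, q_m, p_ℓ, p_m) ↦ (q_ℓ, 0, p_ℓ, 0)`. -/
def linkPart : State n →L[ℝ] State n :=
  (ContinuousLinearMap.fst ℝ _ _).prod ((0 : State n →L[ℝ] V n).prod
    (((ContinuousLinearMap.fst ℝ _ _).comp ((ContinuousLinearMap.snd ℝ _ _).comp
      (ContinuousLinearMap.snd ℝ _ _))).prod 0))

/-- The projection `(q_ℓ, q_m, p_ℓ, p_m) ↦ (q_ℓ, q_m, p_ℓ, 0)`. -/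
def dropMotorMomentum (x : State n) : State n := (x.ql, x.qm, x.pl, 0)

theorem linkPosition_apply (x : State n) : linkPosition x = (x.ql, 0, 0, 0) := rfl

theorem linkPart_apply (x : State n) : linkPart x = (x.ql, 0, x.pl, 0) := rfl

end Projections

namespace Robot

variable {n : ℕ} {R : Robot n} {G : Type} [NormedAddCommGroup G] [NormedSpace ℝ G]

theorem field_ql (x : State n) (u : V n) : (R.field x u).ql = (R.Ml x.ql)⁻¹ *ᵥ x.pl := by
  rw [field_eq_virtualField, virtualField_eq]; rfl

/-- If `F` sees only the part `P` of the states, then its total derivative sees only the parts `P`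
of the states and of the vector fields. -/
theorem dot_congr {F : State n → State n → ℝ → G} (hF : SmoothIn F) (P : State n →L[ℝ] State n)
    (h : ∀ xv x t, F (P xv) (P x) t = F xv x t) {xv yv x y : State n} (t : ℝ)
    (h1 : P xv = P yv) (h2 : P x = P y)
    (h3 : P (R.virtualField xv x 0) = P (R.virtualField yv y 0))
    (h4 : P (R.field x 0) = P (R.field y 0)) :
    R.dot F xv x t = R.dot F yv y t := by
  let Q : State n × State n × ℝ →L[ℝ] State n × State n × ℝ :=
    P.prodMap (P.prodMap (ContinuousLinearMap.id ℝ ℝ))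
  have hQ : (fun y : State n × State n × ℝ => F y.1 y.2.1 y.2.2) =
      (fun y : State n × State n × ℝ => F y.1 y.2.1 y.2.2) ∘ Q :=
    funext fun y => (h y.1 y.2.1 y.2.2).symm
  have key : ∀ xv x, R.dot F xv x t =
      fderiv ℝ (fun y : State n × State n × ℝ => F y.1 y.2.1 y.2.2) (P xv, P x, t)
        (P (R.virtualField xv x 0), P (R.field x 0), 1) := by
    intro xv x
    unfold dot
    conv_lhs => rw [hQ]
    rw [fderiv_comp _ (hF.differentiable (by simp) _) Q.differentiableAt, Q.fderiv]
    rfl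
  rw [key, key, h1, h2, h3, h4]

/-- The total derivative of a function that does not see the motor momenta is its derivative along
the robot, whatever the motor torque. -/
theorem hasDerivAt_along {F : State n → State n → ℝ → G} (hF : SmoothIn F) {t : ℝ}
    (h : ∀ xv x, F (dropMotorMomentum xv) (dropMotorMomentum x) t = F xv x t)
    {x : ℝ → State n} {u : V n} (hx : HasDerivAt x (R.field (x t) u) t) :
    HasDerivAt (fun s => F (x s) (x s) s) (R.dot F (x t) (x t) t) t := by
  have hd := (hF.differentiable (by simp) (x t, x t, t)).hasFDerivAt
  have h1 := hd.comp_hasDerivAt t (hx.prodMk (hx.prodMk (hasDerivAt_id t)))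
  refine h1.congr_deriv ?_
  let e : State n := (0, 0, 0, u)
  have hline : HasDerivAt (fun s : ℝ => ((x t, x t, t) : State n × State n × ℝ) + s • (e, e, 0))
      (e, e, 0) 0 := by
    simpa using ((hasDerivAt_id (0 : ℝ)).smul_const
      ((e, e, 0) : State n × State n × ℝ)).const_add (x t, x t, t)
  have hd' : HasFDerivAt (fun y : State n × State n × ℝ => F y.1 y.2.1 y.2.2)
      (fderiv ℝ (fun y : State n × State n × ℝ => F y.1 y.2.1 y.2.2) (x t, x t, t))
      ((x t, x t, t) + (0 : ℝ) • ((e, e, 0) : State n × State n × ℝ)) := by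
    simpa using hd
  have h2 := hd'.comp_hasDerivAt (0 : ℝ) hline
  have h3 : (fun y : State n × State n × ℝ => F y.1 y.2.1 y.2.2) ∘
      (fun s : ℝ => ((x t, x t, t) : State n × State n × ℝ) + s • (e, e, 0)) =
      fun _ => F (x t) (x t) t := by
    funext s
    simp only [Function.comp, Prod.snd_add, Prod.fst_add, Prod.smul_fst, Prod.smul_snd, smul_zero,
      add_zero]
    rw [← h, ← h (x t) (x t)]
    simp [dropMotorMomentum, e, State.ql, State.qm, State.pl]
  rw [h3] at h2
  have h4 := h2.unique (hasDerivAt_const _ _)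
  have h5 : R.field (x t) u = R.field (x t) 0 + e := by
    rw [field_eq_virtualField, field_eq_virtualField, virtualField_eq, virtualField_eq]
    simp [e]
  have h6 : ((R.field (x t) u, R.field (x t) u, 1) : State n × State n × ℝ) =
      (R.virtualField (x t) (x t) 0, R.field (x t) 0, 1) + (e, e, 0) := by
    rw [h5, ← field_eq_virtualField]
    simp
  rw [h6, map_add, h4, add_zero]
  rfl

end Robot

namespace Design.Admissible

variable {n : ℕ} {R : Robot n} {C : Design n} (hC : C.Admissible R)

include hC

theorem ul_linkPart (xv x : State n) (t : ℝ) :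
    C.ul R (linkPart xv) (linkPart x) t = C.ul R xv x t := by
  have h : R.dot (C.plr R) (linkPart xv) (linkPart x) t = R.dot (C.plr R) xv x t := by
    refine Robot.dot_congr hC.smooth_plr linkPosition (fun _ _ _ => rfl) t rfl rfl ?_ ?_
    · simp only [R.virtualField_eq]; rfl
    · simp only [linkPosition_apply, Robot.field_ql]; rfl
  unfold Design.ul
  rw [h]
  rfl

theorem qmd_linkPart (xv x : State n) (t : ℝ) :
    C.qmd R (linkPart xv) (linkPart x) t = C.qmd R xv x t := by
  unfold Design.qmd
  rw [hC.ul_linkPart]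
  rfl

theorem qmd_congr {xv yv : State n} (x : State n) (t : ℝ) (hq : xv.ql = yv.ql)
    (hp : xv.pl = yv.pl) : C.qmd R xv x t = C.qmd R yv x t := by
  rw [← hC.qmd_linkPart, ← hC.qmd_linkPart yv, linkPart_apply xv, linkPart_apply yv, hq, hp]

theorem qmd_dropMotorMomentum (xv x : State n) (t : ℝ) :
    C.qmd R (dropMotorMomentum xv) (dropMotorMomentum x) t = C.qmd R xv x t := by
  rw [← hC.qmd_linkPart, ← hC.qmd_linkPart xv]
  rfl

theorem errQm_dropMotorMomentum (xv x : State n) (t : ℝ) :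
    C.errQm R (dropMotorMomentum xv) (dropMotorMomentum x) t = C.errQm R xv x t := by
  unfold Design.errQm
  rw [hC.qmd_dropMotorMomentum]
  rfl

/-- The total derivative of the motor reference does not see the motor momenta: these enter the
vector fields of the link variables through no term. -/
theorem dot_qmd_congr {xv yv x y : State n} (t : ℝ)
    (h1 : dropMotorMomentum xv = dropMotorMomentum yv)
    (h2 : dropMotorMomentum x = dropMotorMomentum y) :
    R.dot (C.qmd R) xv x t = R.dot (C.qmd R) yv y t := by
  simp only [dropMotorMomentum, Prod.mk.injEq, and_true] at h1 h2
  obtain ⟨a1, a2, a3⟩ := h1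
  obtain ⟨b1, b2, b3⟩ := h2
  have hE : R.EDl x = R.EDl y := by unfold Robot.EDl; rw [b1, b3]
  refine Robot.dot_congr hC.smooth_qmd linkPart hC.qmd_linkPart t ?_ ?_ ?_ ?_
  · rw [linkPart_apply, linkPart_apply, a1, a3]
  · rw [linkPart_apply, linkPart_apply, b1, b3]
  · simp only [R.virtualField_eq, linkPart_apply, State.ql, State.pl] at *
    simp only [State.qm] at *
    rw [a1, a2, a3, b1, hE]
  · simp only [R.field_eq_virtualField, R.virtualField_eq, linkPart_apply, State.ql, State.pl] at *
    simp only [State.qm] at *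
    rw [b1, b2, b3, hE]

/-- The motor error velocity along the virtual system. -/
theorem dot_errQm (xv x : State n) (t : ℝ) :
    R.dot (C.errQm R) xv x t = (R.Mm x.qm)⁻¹ *ᵥ xv.pm - R.dot (C.qmd R) xv x t := by
  have h1 := (hC.smooth_qmd.differentiable (by simp) (xv, x, t)).hasFDerivAt
  have h2 : HasFDerivAt (fun y : State n × State n × ℝ => y.1.qm) _ (xv, x, t) :=
    (((ContinuousLinearMap.fst ℝ (V n) (V n × V n)).comp
      (ContinuousLinearMap.snd ℝ (V n) (V n × V n × V n))).comp
      (ContinuousLinearMap.fst ℝ (State n) (State n × ℝ))).hasFDerivAt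
  have h3 : fderiv ℝ (fun y : State n × State n × ℝ => C.errQm R y.1 y.2.1 y.2.2) (xv, x, t) = _ :=
    (h2.sub h1).fderiv
  unfold Robot.dot
  rw [h3, R.virtualField_eq]
  rfl

theorem dot_errQl (xv x : State n) (t : ℝ) :
    R.dot (fun xv _ t => C.errQl xv t) xv x t = (R.Ml x.ql)⁻¹ *ᵥ xv.pl - deriv C.qd t := by
  have h1 : HasFDerivAt (fun y : State n × State n × ℝ => C.qd y.2.2) _ (xv, x, t) :=
    ((hC.qd_smooth.differentiable (by simp) t).hasFDerivAt).comp (xv, x, t)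
      ((ContinuousLinearMap.snd ℝ (State n) ℝ).comp
        (ContinuousLinearMap.snd ℝ (State n) (State n × ℝ))).hasFDerivAt
  have h2 : HasFDerivAt (fun y : State n × State n × ℝ => y.1.ql) _ (xv, x, t) :=
    ((ContinuousLinearMap.fst ℝ (V n) (V n × V n × V n)).comp
      (ContinuousLinearMap.fst ℝ (State n) (State n × ℝ))).hasFDerivAt
  have h3 : fderiv ℝ (fun y : State n × State n × ℝ => C.errQl y.1 y.2.2) (xv, x, t) = _ :=
    (h2.sub h1).fderiv
  unfold Robot.dot
  rw [h3, R.virtualField_eq]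
  rfl

/-- Position error and error velocity of the link can be prescribed independently. -/
theorem exists_errQl (z w : V n) (t : ℝ) : ∃ xv x : State n,
    C.errQl xv t = z ∧ R.dot (fun xv _ t => C.errQl xv t) xv x t = w := by
  refine ⟨(z + C.qd t, 0, R.Ml 0 *ᵥ (w + deriv C.qd t), 0), 0, ?_, ?_⟩
  · simp [Design.errQl, State.ql]
  · rw [hC.dot_errQl]
    simp only [State.pl, State.ql, Prod.fst_zero]
    rw [inv_mulVec_mulVec (R.Ml_posDef _)]
    simp

/-- Position error and error velocity of the motor can be prescribed independently, since the motor
reference and its total derivative do not see the motor momentum. -/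
theorem exists_errQm (z w : V n) (t : ℝ) : ∃ xv x : State n,
    C.errQm R xv x t = z ∧ R.dot (C.errQm R) xv x t = w := by
  let a : State n := (0, z + C.qmd R 0 0 t, 0, 0)
  let xv : State n := (0, z + C.qmd R 0 0 t, 0, R.Mm 0 *ᵥ (w + R.dot (C.qmd R) a 0 t))
  refine ⟨xv, 0, ?_, ?_⟩
  · have h : C.qmd R xv 0 t = C.qmd R 0 0 t := hC.qmd_congr 0 t rfl rfl
    rw [Design.errQm, h]
    exact add_sub_cancel_right z _
  · have h : R.dot (C.qmd R) xv 0 t = R.dot (C.qmd R) a 0 t := hC.dot_qmd_congr t rfl rfl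
    rw [hC.dot_errQm, h]
    change (R.Mm 0)⁻¹ *ᵥ (R.Mm 0 *ᵥ (w + R.dot (C.qmd R) a 0 t)) - _ = w
    rw [inv_mulVec_mulVec (R.Mm_posDef _), add_sub_cancel_right]

end Design.Admissible

/-! ### The metrics do not depend on the position error -/

section Metric

variable {n : ℕ} {A : V n → ℝ → Matrix (Fin n) (Fin n) ℝ}

/-- The entrywise derivative of a metric `A(z, t)` at `(z, t)` in the direction `(w, s)`. -/
def metricFDeriv (A : V n → ℝ → Matrix (Fin n) (Fin n) ℝ) (z : V n) (t : ℝ) (w : V n) (s : ℝ) :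
    Matrix (Fin n) (Fin n) ℝ :=
  Matrix.of fun i j => fderiv ℝ (fun y : V n × ℝ => A y.1 y.2 i j) (z, t) (w, s)

theorem hasFDerivAt_metric (hA : ∀ i j, ContDiff ℝ ∞ fun y : V n × ℝ => A y.1 y.2 i j)
    (i j : Fin n) (y : V n × ℝ) :
    HasFDerivAt (fun y : V n × ℝ => A y.1 y.2 i j)
      (fderiv ℝ (fun y : V n × ℝ => A y.1 y.2 i j) y) y :=
  ((hA i j).differentiable (by simp) y).hasFDerivAt

theorem metricFDeriv_smul_one (z : V n) (t r : ℝ) (w : V n) :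
    metricFDeriv A z t (r • w) 1 = r • metricFDeriv A z t w 0 + metricFDeriv A z t 0 1 := by
  ext i j
  have h : ((r • w, 1) : V n × ℝ) = r • (w, 0) + (0, 1) := by simp
  simp only [metricFDeriv, Matrix.of_apply, Matrix.add_apply, Matrix.smul_apply, h, map_add,
    map_smul]

theorem jacobian_mulVec (φ : V n → V n) (z v : V n) : jacobian φ z *ᵥ v = fderiv ℝ φ z v := by
  funext i
  conv_rhs => rw [pi_eq_sum_univ' v, map_sum]
  simp [jacobian, Matrix.mulVec, dotProduct, map_smul, mul_comm]

theorem eq_of_quadratic_eq {B₁ B₂ : Matrix (Fin n) (Fin n) ℝ} (h₁ : B₁ᵀ = B₁) (h₂ : B₂ᵀ = B₂)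
    (h : ∀ v, v ⬝ᵥ B₁ *ᵥ v = v ⬝ᵥ B₂ *ᵥ v) : B₁ = B₂ := by
  have hb : ∀ u v, u ⬝ᵥ B₁ *ᵥ v = u ⬝ᵥ B₂ *ᵥ v := by
    intro u v
    have h3 := h (u + v)
    simp only [Matrix.mulVec_add, dotProduct_add, add_dotProduct] at h3
    rw [dotProduct_mulVec_symm h₁ v u, dotProduct_mulVec_symm h₂ v u, h u, h v] at h3
    linarith
  ext i j
  simpa using hb (Pi.single i 1) (Pi.single j 1)

/-- The contraction inequality as a bound on quadratic forms, the error and its velocity being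
independent. -/
theorem quadratic_le_of_contraction {R : Robot n} {φ : V n → V n} {β : V n → ℝ → ℝ}
    {E : State n → State n → ℝ → V n}
    (hA : ∀ i j, ContDiff ℝ ∞ fun y : V n × ℝ => A y.1 y.2 i j) (hE : SmoothIn E)
    (hex : ∀ z w t, ∃ xv x, E xv x t = z ∧ R.dot E xv x t = w)
    (h : Design.ContractionInequality R A φ β E) {t : ℝ} (ht : 0 ≤ t) (hs : ∀ z, (A z t)ᵀ = A z t)
    (z w v : V n) :
    v ⬝ᵥ metricFDeriv A z t w 1 *ᵥ v ≤
      2 * ((A z t *ᵥ v) ⬝ᵥ fderiv ℝ φ z v) - 2 * β z t * (v ⬝ᵥ A z t *ᵥ v) := by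
  obtain ⟨xv, x, hz, hw⟩ := hex z w t
  have hrate : Design.metricRate R A E xv x t = metricFDeriv A z t w 1 := by
    ext i j
    simp only [Design.metricRate, metricFDeriv, Matrix.of_apply]
    have h1 := (hE.differentiable (by simp) (xv, x, t)).hasFDerivAt.prodMk
      (((ContinuousLinearMap.snd ℝ (State n) ℝ).comp
        (ContinuousLinearMap.snd ℝ (State n) (State n × ℝ))).hasFDerivAt (x := (xv, x, t)))
    have h2 := hasFDerivAt_metric hA i j (E xv x t, t)
    have h3 := (h2.comp (xv, x, t) h1).fderiv
    simp only [Function.comp_def] at h3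
    change fderiv ℝ (fun y : State n × State n × ℝ => A (E y.1 y.2.1 y.2.2) y.2.2 i j)
      (xv, x, t) = _ at h3
    unfold Robot.dot at hw ⊢
    rw [h3, ← hw, ← hz]
    rfl
  have h1 := (h xv x t ht).dotProduct_mulVec_nonneg v
  rw [hrate, hz] at h1
  simp only [star_trivial, Matrix.sub_mulVec, dotProduct_sub, Matrix.smul_mulVec, dotProduct_smul,
    smul_eq_mul, ← Matrix.mulVec_mulVec, jacobian_mulVec] at h1
  have h2 : v ⬝ᵥ A z t *ᵥ fderiv ℝ φ z v = (A z t *ᵥ v) ⬝ᵥ fderiv ℝ φ z v := by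
    rw [dotProduct_mulVec_symm (hs z), dotProduct_comm]
  have h3 : v ⬝ᵥ (jacobian φ z)ᵀ *ᵥ (A z t *ᵥ v) = (A z t *ᵥ v) ⬝ᵥ fderiv ℝ φ z v := by
    rw [Matrix.dotProduct_mulVec, Matrix.vecMul_transpose, jacobian_mulVec, dotProduct_comm]
  rw [h2, h3] at h1
  linarith

/-- The contraction inequality is required for all error velocities `w`, while its left-hand side
is affine in `w`. So the metric cannot depend on the position error. -/
theorem metric_eq_zero_position {R : Robot n} {φ : V n → V n} {β : V n → ℝ → ℝ}
    {E : State n → State n → ℝ → V n}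
    (hA : ∀ i j, ContDiff ℝ ∞ fun y : V n × ℝ => A y.1 y.2 i j) (hE : SmoothIn E)
    (hex : ∀ z w t, ∃ xv x, E xv x t = z ∧ R.dot E xv x t = w)
    (h : Design.ContractionInequality R A φ β E) {t : ℝ} (ht : 0 ≤ t) (hs : ∀ z, (A z t)ᵀ = A z t)
    (z : V n) : A z t = A 0 t := by
  have hzero : ∀ z w v : V n, v ⬝ᵥ metricFDeriv A z t w 0 *ᵥ v = 0 := by
    intro z w v
    have h1 := fun r : ℝ => quadratic_le_of_contraction hA hE hex h ht hs z (r • w) v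
    simp only [metricFDeriv_smul_one, Matrix.add_mulVec, Matrix.smul_mulVec, dotProduct_add,
      dotProduct_smul, smul_eq_mul] at h1
    set D := v ⬝ᵥ metricFDeriv A z t w 0 *ᵥ v
    set D' := v ⬝ᵥ metricFDeriv A z t 0 1 *ᵥ v
    set S := 2 * ((A z t *ᵥ v) ⬝ᵥ fderiv ℝ φ z v) - 2 * β z t * (v ⬝ᵥ A z t *ᵥ v)
    by_contra hD
    have h2 := h1 ((S - D' + 1) / D)
    rw [div_mul_cancel₀ _ hD] at h2
    linarith
  refine eq_of_quadratic_eq (hs z) (hs 0) fun v => ?_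
  have hd : ∀ s : ℝ, HasDerivAt (fun s : ℝ => v ⬝ᵥ A (s • z) t *ᵥ v) 0 s := by
    intro s
    have hline : HasDerivAt (fun s : ℝ => ((s • z, t) : V n × ℝ)) (z, 0) s := by
      simpa using ((hasDerivAt_id s).smul_const z).prodMk (hasDerivAt_const s t)
    have hentry : ∀ i j, HasDerivAt (fun s : ℝ => A (s • z) t i j)
        (metricFDeriv A (s • z) t z 0 i j) s := fun i j => by
      have h2 := hasFDerivAt_metric hA i j (s • z, t)
      exact h2.comp_hasDerivAt s hline
    have h1 := hasDerivAt_dotProduct (hasDerivAt_const s v)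
      (hasDerivAt_mulVec hentry (hasDerivAt_const s v))
    refine h1.congr_deriv ?_
    simp [hzero]
  have h1 := is_const_of_deriv_eq_zero (fun s => (hd s).differentiableAt) (fun s => (hd s).deriv)
    1 0
  simpa using h1

theorem lineIntegral_of_const {t : ℝ} (h : ∀ z, A z t = A 0 t) (z : V n) :
    lineIntegral A z t = A 0 t *ᵥ z := by
  simp [lineIntegral, h (_ • z)]

/-- The time derivative of a metric at zero error. -/
def metricDeriv (A : V n → ℝ → Matrix (Fin n) (Fin n) ℝ) (t : ℝ) : Matrix (Fin n) (Fin n) ℝ :=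
  metricFDeriv A 0 t 0 1

theorem hasDerivAt_metric (hA : ∀ i j, ContDiff ℝ ∞ fun y : V n × ℝ => A y.1 y.2 i j)
    (z : V n) (t : ℝ) (i j : Fin n) :
    HasDerivAt (fun s => A z s i j) (metricFDeriv A z t 0 1 i j) t := by
  have h1 : HasDerivAt (fun s : ℝ => ((z, s) : V n × ℝ)) (0, 1) t :=
    (hasDerivAt_const t z).prodMk (hasDerivAt_id t)
  exact (hasFDerivAt_metric hA i j (z, t)).comp_hasDerivAt t h1

theorem metricFDeriv_time (hA : ∀ i j, ContDiff ℝ ∞ fun y : V n × ℝ => A y.1 y.2 i j)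
    (hconst : ∀ t, 0 ≤ t → ∀ z, A z t = A 0 t) {t : ℝ} (ht : 0 < t) (z : V n) :
    metricFDeriv A z t 0 1 = metricDeriv A t := by
  ext i j
  refine (hasDerivAt_metric hA z t i j).unique ?_
  refine (hasDerivAt_metric hA 0 t i j).congr_of_eventuallyEq ?_
  filter_upwards [lt_mem_nhds ht] with s hs
  rw [hconst s hs.le z]

/-- Integration of the contraction inequality along the ray from `0` to the error `e`. -/
theorem ray_inequality {φ : V n → V n} (hφ : ContDiff ℝ ∞ φ) (hφ0 : φ 0 = 0)
    {B B' : Matrix (Fin n) (Fin n) ℝ} {β : V n → ℝ} {e : V n} {b : ℝ}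
    (hB : 0 ≤ e ⬝ᵥ B *ᵥ e)
    (h : ∀ z, e ⬝ᵥ B' *ᵥ e ≤ 2 * ((B *ᵥ e) ⬝ᵥ fderiv ℝ φ z e) - 2 * β z * (e ⬝ᵥ B *ᵥ e))
    (hb : ∀ θ ∈ Icc (0 : ℝ) 1, b ≤ β (θ • e)) :
    (1 / 2 : ℝ) * (e ⬝ᵥ B' *ᵥ e) - (B *ᵥ e) ⬝ᵥ φ e ≤ -b * (e ⬝ᵥ B *ᵥ e) := by
  set S := (1 / 2 : ℝ) * (e ⬝ᵥ B' *ᵥ e) + b * (e ⬝ᵥ B *ᵥ e) with hS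
  have hd : ∀ θ : ℝ, HasDerivAt (fun θ : ℝ => (B *ᵥ e) ⬝ᵥ φ (θ • e) - θ * S)
      ((B *ᵥ e) ⬝ᵥ fderiv ℝ φ (θ • e) e - S) θ := by
    intro θ
    have hline : HasDerivAt (fun θ : ℝ => θ • e) e θ := by
      simpa using (hasDerivAt_id θ).smul_const e
    have h1 := ((hφ.differentiable (by simp) (θ • e)).hasFDerivAt).comp_hasDerivAt θ hline
    have h2 := (hasDerivAt_dotProduct (hasDerivAt_const θ (B *ᵥ e)) h1).sub
      ((hasDerivAt_id θ).mul_const S)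
    refine h2.congr_deriv ?_
    simp
  have hmono : MonotoneOn (fun θ : ℝ => (B *ᵥ e) ⬝ᵥ φ (θ • e) - θ * S) (Icc 0 1) := by
    refine monotoneOn_of_deriv_nonneg (convex_Icc 0 1)
      (fun θ _ => (hd θ).continuousAt.continuousWithinAt)
      (fun θ _ => (hd θ).differentiableAt.differentiableWithinAt) fun θ hθ => ?_
    rw [interior_Icc] at hθ
    rw [(hd θ).deriv]
    have h1 := h (θ • e)
    have h2 := mul_le_mul_of_nonneg_right (hb θ ⟨hθ.1.le, hθ.2.le⟩) hB
    rw [hS]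
    linarith
  have h1 := hmono (left_mem_Icc.2 zero_le_one) (right_mem_Icc.2 zero_le_one) zero_le_one
  simp only [zero_smul, hφ0, dotProduct_zero, zero_mul, sub_zero, one_smul, one_mul] at h1
  rw [hS] at h1
  linarith

end Metric

namespace Design.Admissible

variable {n : ℕ} {R : Robot n} {C : Design n} (hC : C.Admissible R)

include hC

theorem metl_symm (z : V n) {t : ℝ} (ht : 0 ≤ t) : (C.metl z t)ᵀ = C.metl z t :=
  transpose_eq_of_posDef (hC.metl_posDef z t ht)

theorem metm_symm (z : V n) {t : ℝ} (ht : 0 ≤ t) : (C.metm z t)ᵀ = C.metm z t :=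
  transpose_eq_of_posDef (hC.metm_posDef z t ht)

theorem metl_const (t : ℝ) (ht : 0 ≤ t) (z : V n) : C.metl z t = C.metl 0 t :=
  metric_eq_zero_position hC.metl_smooth hC.smooth_errQl hC.exists_errQl hC.contraction_l ht
    (fun z => hC.metl_symm z ht) z

theorem metm_const (t : ℝ) (ht : 0 ≤ t) (z : V n) : C.metm z t = C.metm 0 t :=
  metric_eq_zero_position hC.metm_smooth hC.smooth_errQm hC.exists_errQm hC.contraction_m ht
    (fun z => hC.metm_symm z ht) z

theorem ray_l {t : ℝ} (ht : 0 < t) {e : V n} {b : ℝ}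
    (hb : ∀ θ ∈ Icc (0 : ℝ) 1, b ≤ C.βl (θ • e) t) :
    (1 / 2 : ℝ) * (e ⬝ᵥ metricDeriv C.metl t *ᵥ e) - (C.metl 0 t *ᵥ e) ⬝ᵥ C.φl e ≤
      -b * (e ⬝ᵥ C.metl 0 t *ᵥ e) := by
  refine ray_inequality hC.φl_smooth hC.φl_zero (β := fun z => C.βl z t)
    (by simpa using (hC.metl_posDef 0 t ht.le).posSemidef.dotProduct_mulVec_nonneg e)
    (fun z => ?_) hb
  have h := quadratic_le_of_contraction hC.metl_smooth hC.smooth_errQl hC.exists_errQl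
    hC.contraction_l ht.le (fun z => hC.metl_symm z ht.le) z 0 e
  rwa [metricFDeriv_time hC.metl_smooth hC.metl_const ht, hC.metl_const t ht.le z] at h

theorem ray_m {t : ℝ} (ht : 0 < t) {e : V n} {b : ℝ}
    (hb : ∀ θ ∈ Icc (0 : ℝ) 1, b ≤ C.βm (θ • e) t) :
    (1 / 2 : ℝ) * (e ⬝ᵥ metricDeriv C.metm t *ᵥ e) - (C.metm 0 t *ᵥ e) ⬝ᵥ C.φm e ≤
      -b * (e ⬝ᵥ C.metm 0 t *ᵥ e) := by
  refine ray_inequality hC.φm_smooth hC.φm_zero (β := fun z => C.βm z t)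
    (by simpa using (hC.metm_posDef 0 t ht.le).posSemidef.dotProduct_mulVec_nonneg e)
    (fun z => ?_) hb
  have h := quadratic_le_of_contraction hC.metm_smooth hC.smooth_errQm hC.exists_errQm
    hC.contraction_m ht.le (fun z => hC.metm_symm z ht.le) z 0 e
  rwa [metricFDeriv_time hC.metm_smooth hC.metm_const ht, hC.metm_const t ht.le z] at h

/-- The coupling velocity in closed form. As the metric does not depend on the error, the prescribed
variation is that of a multiple of `σ_ℓv`, and both sides vanish at zero error. -/
theorem vbar_eq (xv x : State n) {t : ℝ} (ht : 0 ≤ t) :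
    C.vbar xv x t =
      -((C.metm 0 t)⁻¹ *ᵥ (R.K *ᵥ ((R.Ml x.ql)⁻¹ *ᵥ C.sigmaL R xv x t))) := by
  set B : Matrix (Fin n) (Fin n) ℝ := (C.metm 0 t)⁻¹ * (R.K * (R.Ml x.ql)⁻¹) with hB
  have hBv : ∀ v : V n, B *ᵥ v = (C.metm 0 t)⁻¹ *ᵥ (R.K *ᵥ ((R.Ml x.ql)⁻¹ *ᵥ v)) := fun v => by
    rw [hB, Matrix.mulVec_mulVec, Matrix.mulVec_mulVec, Matrix.mul_assoc]
  let L : V n →L[ℝ] V n := LinearMap.toContinuousLinearMap B.mulVecLin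
  have hin : ContDiff ℝ ∞ fun y : State n => ((y, x, t) : State n × State n × ℝ) :=
    contDiff_id.prodMk contDiff_const
  have hv : ContDiff ℝ ∞ fun y : State n => C.vbar y x t := hC.vbar_smooth.comp hin
  have hσ : ContDiff ℝ ∞ fun y : State n => C.sigmaL R y x t := hC.smooth_sigmaL.comp hin
  have hd : ∀ y, HasFDerivAt (fun y : State n => C.vbar y x t + L (C.sigmaL R y x t))
      (0 : State n →L[ℝ] V n) y := by
    intro y
    have hσ' := (hσ.differentiable (by simp) y).hasFDerivAt
    have hL : HasFDerivAt (fun y : State n => L (C.sigmaL R y x t))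
        (L.comp (fderiv ℝ (fun y : State n => C.sigmaL R y x t) y)) y :=
      (L.hasFDerivAt (x := C.sigmaL R y x t)).comp y hσ'
    have h1 := (hv.differentiable (by simp) y).hasFDerivAt.add hL
    refine h1.congr_fderiv ?_
    refine ContinuousLinearMap.ext fun δ => ?_
    rw [add_apply, hC.vbar_variation y x t ht δ, hC.metm_const t ht, R.K_symm,
      transpose_inv_of_posDef (R.Ml_posDef _), ← hBv]
    simp [L]
  -- the virtual state at which all errors vanish
  let a : State n := (C.qd t, 0, 0, 0)
  let b : State n := (C.qd t, 0, C.plr R a x t, 0)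
  let y₀ : State n := (C.qd t, C.qmd R b x t, C.plr R a x t, 0)
  have hy2 : C.sigmaL R y₀ x t = 0 := by
    change C.plr R a x t - C.plr R a x t = 0
    exact sub_self _
  have hy : C.vbar y₀ x t = 0 := by
    refine hC.vbar_zero y₀ x t ht ?_ ?_ hy2
    · change C.qd t - C.qd t = 0
      exact sub_self _
    · have h : C.qmd R y₀ x t = C.qmd R b x t := hC.qmd_congr x t rfl rfl
      rw [Design.errQm, h]
      exact sub_self _
  have h1 := is_const_of_fderiv_eq_zero (𝕜 := ℝ) (fun y => (hd y).differentiableAt)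
    (fun y => (hd y).fderiv) xv y₀
  simp only [hy, hy2, map_zero, add_zero] at h1
  rw [← hBv]
  exact eq_neg_of_add_eq_zero_left h1

theorem pmr_dropMotorMomentum {t : ℝ} (ht : 0 ≤ t) (xv x : State n) :
    C.pmr R (dropMotorMomentum xv) (dropMotorMomentum x) t = C.pmr R xv x t := by
  unfold Design.pmr
  rw [hC.vbar_eq _ _ ht, hC.vbar_eq _ _ ht, hC.errQm_dropMotorMomentum,
    hC.dot_qmd_congr (xv := dropMotorMomentum xv) (x := dropMotorMomentum x) (yv := xv) (y := x) t
      rfl rfl]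
  rfl

end Design.Admissible

/-! ### The least eigenvalue -/

section LambdaMin

theorem zero_le_dotProduct_self {ι : Type*} [Fintype ι] (v : ι → ℝ) : 0 ≤ v ⬝ᵥ v :=
  Finset.sum_nonneg fun i _ => mul_self_nonneg (v i)

variable {ι : Type*} [Fintype ι] [DecidableEq ι]

theorem smul_one_mulVec_quadratic (c : ℝ) (v : ι → ℝ) :
    v ⬝ᵥ (algebraMap ℝ (Matrix ι ι ℝ) c) *ᵥ v = c * (v ⬝ᵥ v) := by
  rw [Algebra.algebraMap_eq_smul_one, Matrix.smul_mulVec, Matrix.one_mulVec, dotProduct_smul,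
    smul_eq_mul]

theorem isHermitian_sub_algebraMap {A : Matrix ι ι ℝ} (hA : A.IsHermitian) (c : ℝ) :
    (-algebraMap ℝ (Matrix ι ι ℝ) c + A).IsHermitian := by
  refine Matrix.IsHermitian.add (Matrix.IsHermitian.neg ?_) hA
  rw [Algebra.algebraMap_eq_smul_one]
  exact Matrix.isHermitian_one.smul (IsSelfAdjoint.all c)

theorem finite_spectrum {A : Matrix ι ι ℝ} (hA : A.IsHermitian) : (spectrum ℝ A).Finite := by
  rw [hA.spectrum_real_eq_range_eigenvalues]
  exact finite_range _

theorem nonempty_spectrum [Nonempty ι] {A : Matrix ι ι ℝ} (hA : A.IsHermitian) :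
    (spectrum ℝ A).Nonempty := by
  rw [hA.spectrum_real_eq_range_eigenvalues]
  exact range_nonempty _

theorem lambdaMin_mul_le {A : Matrix ι ι ℝ} (hA : A.IsHermitian) (v : ι → ℝ) :
    lambdaMin A * (v ⬝ᵥ v) ≤ v ⬝ᵥ A *ᵥ v := by
  have h : (-algebraMap ℝ (Matrix ι ι ℝ) (lambdaMin A) + A).PosSemidef := by
    refine Matrix.posSemidef_iff_isHermitian_and_spectrum_nonneg.2
      ⟨isHermitian_sub_algebraMap hA _, fun r hr => ?_⟩
    have h1 := csInf_le (finite_spectrum hA).bddBelow (spectrum.add_mem_iff.2 hr)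
    change lambdaMin A ≤ _ at h1
    simpa using h1
  have h1 := h.dotProduct_mulVec_nonneg v
  rw [star_trivial, Matrix.add_mulVec, Matrix.neg_mulVec, dotProduct_add, dotProduct_neg,
    smul_one_mulVec_quadratic] at h1
  linarith

theorem le_lambdaMin [Nonempty ι] {A : Matrix ι ι ℝ} (hA : A.IsHermitian) {c : ℝ}
    (h : ∀ v : ι → ℝ, c * (v ⬝ᵥ v) ≤ v ⬝ᵥ A *ᵥ v) : c ≤ lambdaMin A := by
  refine le_csInf (nonempty_spectrum hA) fun r hr => ?_
  have hp : (-algebraMap ℝ (Matrix ι ι ℝ) c + A).PosSemidef := by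
    refine Matrix.PosSemidef.of_dotProduct_mulVec_nonneg (isHermitian_sub_algebraMap hA _)
      fun v => ?_
    rw [star_trivial, Matrix.add_mulVec, Matrix.neg_mulVec, dotProduct_add, dotProduct_neg,
      smul_one_mulVec_quadratic]
    linarith [h v]
  have h1 := (Matrix.posSemidef_iff_isHermitian_and_spectrum_nonneg.1 hp).2
  have h2 : (r - c) + c ∈ spectrum ℝ A := by simpa using hr
  have h3 := h1 (spectrum.add_mem_iff.1 h2)
  change 0 ≤ r - c at h3
  linarith

theorem lambdaMin_nonneg {A : Matrix ι ι ℝ} (hA : A.PosSemidef) : 0 ≤ lambdaMin A :=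
  Real.sInf_nonneg fun _ hr =>
    (Matrix.posSemidef_iff_isHermitian_and_spectrum_nonneg.1 hA).2 hr

theorem lambdaMin_pos [Nonempty ι] {A : Matrix ι ι ℝ} (hA : A.PosDef) : 0 < lambdaMin A := by
  have h := (nonempty_spectrum hA.isHermitian).csInf_mem (finite_spectrum hA.isHermitian)
  rw [hA.isHermitian.spectrum_real_eq_range_eigenvalues] at h
  obtain ⟨i, hi⟩ := h
  rw [lambdaMin, hA.isHermitian.spectrum_real_eq_range_eigenvalues, ← hi]
  exact hA.eigenvalues_pos i

/-- With `v = M⁻¹ σ`: `λ_min(M⁻¹) σᵀ M⁻¹ σ ≤ |v|²`. -/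
theorem lambdaMin_inv_mul_le {M : Matrix ι ι ℝ} (hM : M.PosDef) (v : ι → ℝ) :
    lambdaMin M⁻¹ * (v ⬝ᵥ M *ᵥ v) ≤ v ⬝ᵥ v := by
  set l := lambdaMin M⁻¹
  have hl : 0 ≤ l := lambdaMin_nonneg hM.inv.posSemidef
  have h1 := lambdaMin_mul_le hM.inv.isHermitian (M *ᵥ v)
  rw [inv_mulVec_mulVec hM, dotProduct_comm (M *ᵥ v) v] at h1
  -- expand `0 ≤ |v - l M v|²`
  have h2 := zero_le_dotProduct_self (v - l • M *ᵥ v)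
  simp only [sub_dotProduct, dotProduct_sub, smul_dotProduct, dotProduct_smul, smul_eq_mul,
    dotProduct_comm (M *ᵥ v) v] at h2
  have h3 := mul_le_mul_of_nonneg_left h1 hl
  change l * (l * _) ≤ _ at h3
  linarith

theorem inv_le_lambdaMin_inv [Nonempty ι] {M : Matrix ι ι ℝ} (hM : M.PosDef) {m : ℝ} (hm : 0 < m)
    (h : ∀ v : ι → ℝ, v ⬝ᵥ M *ᵥ v ≤ m * (v ⬝ᵥ v)) : m⁻¹ ≤ lambdaMin M⁻¹ := by
  refine le_lambdaMin hM.inv.isHermitian fun u => ?_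
  -- expand `0 ≤ (v - u/m)ᵀ M (v - u/m)` with `v = M⁻¹ u`
  have h1 := hM.posSemidef.dotProduct_mulVec_nonneg (M⁻¹ *ᵥ u - m⁻¹ • u)
  have h2 := mul_le_mul_of_nonneg_left (h u) (by positivity : 0 ≤ m⁻¹ * m⁻¹)
  have h3 : (M⁻¹ *ᵥ u) ⬝ᵥ M *ᵥ u = u ⬝ᵥ u := by
    rw [dotProduct_mulVec_symm (transpose_eq_of_posDef hM), mulVec_inv_mulVec hM]
  rw [star_trivial, Matrix.mulVec_sub, Matrix.mulVec_smul, mulVec_inv_mulVec hM] at h1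
  simp only [sub_dotProduct, dotProduct_sub, smul_dotProduct, dotProduct_smul, smul_eq_mul,
    h3, dotProduct_comm (M⁻¹ *ᵥ u) u] at h1
  have h4 : m⁻¹ * m⁻¹ * (m * (u ⬝ᵥ u)) = m⁻¹ * (u ⬝ᵥ u) := by field_simp
  linarith

end LambdaMin

/-! ### The momentum rate -/

section Blocks

variable {n : ℕ}

theorem blockDiagonal_quadratic (A D : Matrix (Fin n) (Fin n) ℝ) (v : Fin n ⊕ Fin n → ℝ) :
    v ⬝ᵥ Matrix.fromBlocks A 0 0 D *ᵥ v =
      (v ∘ Sum.inl) ⬝ᵥ A *ᵥ (v ∘ Sum.inl) + (v ∘ Sum.inr) ⬝ᵥ D *ᵥ (v ∘ Sum.inr) := by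
  rw [Matrix.fromBlocks_mulVec]
  simp [dotProduct, Fintype.sum_sum_type]

theorem dotProduct_self_sum (v : Fin n ⊕ Fin n → ℝ) :
    v ⬝ᵥ v = (v ∘ Sum.inl) ⬝ᵥ (v ∘ Sum.inl) + (v ∘ Sum.inr) ⬝ᵥ (v ∘ Sum.inr) := by
  simp [dotProduct, Fintype.sum_sum_type]

theorem posSemidef_blockDiagonal {A D : Matrix (Fin n) (Fin n) ℝ} (hA : A.PosSemidef)
    (hD : D.PosSemidef) : (Matrix.fromBlocks A 0 0 D).PosSemidef := by
  refine Matrix.PosSemidef.of_dotProduct_mulVec_nonneg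
    (hA.isHermitian.fromBlocks (by simp) hD.isHermitian) fun v => ?_
  rw [star_trivial, blockDiagonal_quadratic]
  have h1 := hA.dotProduct_mulVec_nonneg (v ∘ Sum.inl)
  have h2 := hD.dotProduct_mulVec_nonneg (v ∘ Sum.inr)
  rw [star_trivial] at h1 h2
  exact add_nonneg h1 h2

theorem posDef_blockDiagonal {A D : Matrix (Fin n) (Fin n) ℝ} (hA : A.PosDef)
    (hD : D.PosDef) : (Matrix.fromBlocks A 0 0 D).PosDef := by
  refine Matrix.PosDef.of_dotProduct_mulVec_pos
    (hA.isHermitian.fromBlocks (by simp) hD.isHermitian) fun v hv => ?_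
  rw [star_trivial, blockDiagonal_quadratic]
  have h1 := hA.posSemidef.dotProduct_mulVec_nonneg (v ∘ Sum.inl)
  have h2 := hD.posSemidef.dotProduct_mulVec_nonneg (v ∘ Sum.inr)
  rw [star_trivial] at h1 h2
  by_cases hl : v ∘ Sum.inl = 0
  · have hr : v ∘ Sum.inr ≠ 0 := by
      intro hr
      refine hv (funext fun i => ?_)
      cases i with
      | inl i => exact congrFun hl i
      | inr i => exact congrFun hr i
    have h3 := hD.dotProduct_mulVec_pos hr
    rw [star_trivial] at h3
    linarith
  · have h3 := hA.dotProduct_mulVec_pos hl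
    rw [star_trivial] at h3
    linarith

end Blocks

namespace Design.Admissible

variable {n : ℕ} {R : Robot n} {C : Design n} (hC : C.Admissible R)

include hC

theorem posDef_gain : (Matrix.fromBlocks C.Kld 0 0 C.Kmd).PosDef :=
  posDef_blockDiagonal hC.Kld_posDef hC.Kmd_posDef

theorem posDef_damping (x : State n) :
    (Matrix.fromBlocks (R.Dl x.ql x.pl) 0 0 (R.Dm x.qm x.pm)
      + Matrix.fromBlocks C.Kld 0 0 C.Kmd).PosDef :=
  Matrix.PosDef.posSemidef_add
    (posSemidef_blockDiagonal (R.Dl_posSemidef _ _) (R.Dm_posSemidef _ _)) hC.posDef_gain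

theorem momentumRate_nonneg (x : State n) : 0 ≤ C.momentumRate R x :=
  mul_nonneg (lambdaMin_nonneg (hC.posDef_damping x).posSemidef)
    (lambdaMin_nonneg (posDef_blockDiagonal (R.Ml_posDef _) (R.Mm_posDef _)).inv.posSemidef)

/-- The damping dominates the kinetic part of the storage function; here `v = M⁻¹ σ`. -/
theorem momentumRate_mul_le (x : State n) (vl vm : V n) :
    C.momentumRate R x * (vl ⬝ᵥ R.Ml x.ql *ᵥ vl + vm ⬝ᵥ R.Mm x.qm *ᵥ vm) ≤
      (vl ⬝ᵥ R.Dl x.ql x.pl *ᵥ vl + vl ⬝ᵥ C.Kld *ᵥ vl)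
        + (vm ⬝ᵥ R.Dm x.qm x.pm *ᵥ vm + vm ⬝ᵥ C.Kmd *ᵥ vm) := by
  have hM := posDef_blockDiagonal (R.Ml_posDef x.ql) (R.Mm_posDef x.qm)
  have hD := hC.posDef_damping x
  let v : Fin n ⊕ Fin n → ℝ := Sum.elim vl vm
  have h1 := lambdaMin_inv_mul_le hM v
  have h2 := lambdaMin_mul_le hD.isHermitian v
  have h3 := mul_le_mul_of_nonneg_left h1 (lambdaMin_nonneg hD.posSemidef)
  have h4 : v ∘ Sum.inl = vl := rfl
  have h5 : v ∘ Sum.inr = vm := rfl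
  rw [Matrix.add_mulVec, dotProduct_add, blockDiagonal_quadratic, blockDiagonal_quadratic,
    h4, h5] at h2
  rw [blockDiagonal_quadratic, h4, h5, ← mul_assoc] at h3
  unfold Design.momentumRate
  linarith

/-- With bounded inertia the momentum rate is bounded below by a positive constant. -/
theorem exists_le_momentumRate (hn : 0 < n) {m : ℝ}
    (hm : ∀ q v : V n, v ⬝ᵥ R.Ml q *ᵥ v ≤ m * (v ⬝ᵥ v) ∧ v ⬝ᵥ R.Mm q *ᵥ v ≤ m * (v ⬝ᵥ v)) :
    ∃ ε > 0, ∀ x, ε ≤ C.momentumRate R x := by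
  have : Nonempty (Fin n) := ⟨⟨0, hn⟩⟩
  have hk := lambdaMin_pos hC.posDef_gain
  have hm' : 0 < max m 1 := lt_max_of_lt_right one_pos
  refine ⟨lambdaMin (Matrix.fromBlocks C.Kld 0 0 C.Kmd) * (max m 1)⁻¹, by positivity,
    fun x => ?_⟩
  refine mul_le_mul ?_ ?_ (by positivity) (lambdaMin_nonneg (hC.posDef_damping x).posSemidef)
  · refine le_lambdaMin (hC.posDef_damping x).isHermitian fun v => ?_
    have h1 := (posSemidef_blockDiagonal (R.Dl_posSemidef x.ql x.pl)
      (R.Dm_posSemidef x.qm x.pm)).dotProduct_mulVec_nonneg v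
    have h2 := lambdaMin_mul_le hC.posDef_gain.isHermitian v
    rw [star_trivial] at h1
    rw [Matrix.add_mulVec, dotProduct_add]
    linarith
  · refine inv_le_lambdaMin_inv (posDef_blockDiagonal (R.Ml_posDef _) (R.Mm_posDef _)) hm'
      fun v => ?_
    rw [blockDiagonal_quadratic, dotProduct_self_sum]
    have h1 := (hm x.ql (v ∘ Sum.inl)).1
    have h2 := (hm x.qm (v ∘ Sum.inr)).2
    have h3 := mul_le_mul_of_nonneg_right (le_max_left m 1)
      (zero_le_dotProduct_self (v ∘ Sum.inl))
    have h4 := mul_le_mul_of_nonneg_right (le_max_left m 1)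
      (zero_le_dotProduct_self (v ∘ Sum.inr))
    linarith

end Design.Admissible

/-! ### Decay of the storage function -/

namespace Design.Admissible

variable {n : ℕ} {R : Robot n} {C : Design n} (hC : C.Admissible R)

/-- The derivative of `eᵀ A(e, t) e` for a metric that does not depend on the error. -/
theorem hasDerivAt_metric_energy {A : V n → ℝ → Matrix (Fin n) (Fin n) ℝ}
    (hA : ∀ i j, ContDiff ℝ ∞ fun y : V n × ℝ => A y.1 y.2 i j)
    (hconst : ∀ t, 0 ≤ t → ∀ z, A z t = A 0 t) {t : ℝ} (ht : 0 < t) (hs : (A 0 t)ᵀ = A 0 t)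
    {e : ℝ → V n} {e' : V n} (he : HasDerivAt e e' t) :
    HasDerivAt (fun s => e s ⬝ᵥ A (e s) s *ᵥ e s)
      (2 * ((A 0 t *ᵥ e t) ⬝ᵥ e') + e t ⬝ᵥ metricDeriv A t *ᵥ e t) t := by
  have h1 := hasDerivAt_dotProduct he (hasDerivAt_mulVec (hasDerivAt_metric hA 0 t) he)
  have h2 : (fun s => e s ⬝ᵥ A (e s) s *ᵥ e s) =ᶠ[𝓝 t] fun s => e s ⬝ᵥ A 0 s *ᵥ e s := by
    filter_upwards [lt_mem_nhds ht] with s hs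
    rw [hconst s hs.le]
  refine (h1.congr_of_eventuallyEq h2).congr_deriv ?_
  rw [dotProduct_add, dotProduct_mulVec_symm hs (e t) e', dotProduct_comm (A 0 t *ᵥ e t) e',
    metricDeriv]
  ring

include hC

/-- The equation of the link position error. -/
theorem hasDerivAt_errQl {x : ℝ → State n} {t : ℝ} {u : V n}
    (hx : HasDerivAt x (R.field (x t) u) t) :
    HasDerivAt (fun s => C.errQl (x s) s)
      ((R.Ml (x t).ql)⁻¹ *ᵥ C.sigmaL R (x t) (x t) t - C.φl (C.errQl (x t) t)) t := by
  have h := Robot.hasDerivAt_along hC.smooth_errQl (fun _ _ => rfl) hx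
  refine h.congr_deriv ?_
  rw [hC.dot_errQl, Design.sigmaL, Design.plr, Matrix.mulVec_sub,
    inv_mulVec_mulVec (R.Ml_posDef _)]
  abel

/-- The equation of the motor position error. -/
theorem hasDerivAt_errQm {x : ℝ → State n} {t : ℝ} {u : V n}
    (hx : HasDerivAt x (R.field (x t) u) t) :
    HasDerivAt (fun s => C.errQm R (x s) (x s) s)
      ((R.Mm (x t).qm)⁻¹ *ᵥ C.sigmaM R (x t) (x t) t - C.φm (C.errQm R (x t) (x t) t)
        + C.vbar (x t) (x t) t) t := by
  have h := Robot.hasDerivAt_along hC.smooth_errQm (hC.errQm_dropMotorMomentum · · t) hx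
  refine h.congr_deriv ?_
  rw [hC.dot_errQm, Design.sigmaM, Design.pmr, Matrix.mulVec_sub,
    inv_mulVec_mulVec (R.Mm_posDef _)]
  abel

/-- The equation of the link momentum error: the spring torque at the motor reference realizes the
link control law. -/
theorem hasDerivAt_sigmaL {x : ℝ → State n} {t : ℝ} (ht : 0 ≤ t) {u : V n}
    (hx : HasDerivAt x (R.field (x t) u) t) :
    HasDerivAt (fun s => C.sigmaL R (x s) (x s) s)
      (R.K *ᵥ C.errQm R (x t) (x t) t
        - R.EDl (x t) *ᵥ ((R.Ml (x t).ql)⁻¹ *ᵥ C.sigmaL R (x t) (x t) t)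
        - C.metl 0 t *ᵥ C.errQl (x t) t
        - C.Kld *ᵥ ((R.Ml (x t).ql)⁻¹ *ᵥ C.sigmaL R (x t) (x t) t)) t := by
  have h1 := Robot.hasDerivAt_along hC.smooth_plr (fun _ _ => rfl) hx
  have h2 : HasDerivAt (fun s => (x s).pl) (R.field (x t) u).pl t := hx.snd.snd.fst
  refine (h2.sub h1).congr_deriv ?_
  have h3 : (R.field (x t) u).pl = -(grad R.Pl (x t).ql - R.K *ᵥ ((x t).qm - (x t).ql))
      - R.EDl (x t) *ᵥ ((R.Ml (x t).ql)⁻¹ *ᵥ (x t).pl) := by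
    rw [R.field_eq_virtualField, R.virtualField_eq]; rfl
  have h4 : R.K *ᵥ ((x t).qm - (x t).ql) =
      R.K *ᵥ C.errQm R (x t) (x t) t + C.ul R (x t) (x t) t := by
    rw [Design.errQm, Design.qmd, Matrix.mulVec_sub, Matrix.mulVec_sub, Matrix.mulVec_add,
      mulVec_inv_mulVec R.K_posDef]
    abel
  have h5 : (x t).pl = C.sigmaL R (x t) (x t) t + C.plr R (x t) (x t) t :=
    (sub_add_cancel _ _).symm
  rw [h3, h4, Design.ul, lineIntegral_of_const (hC.metl_const t ht)]
  conv_lhs => rw [h5]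
  simp only [Matrix.mulVec_add]
  abel

/-- The equation of the motor momentum error. -/
theorem hasDerivAt_sigmaM {x : ℝ → State n} {t : ℝ} (ht : 0 ≤ t)
    (hx : HasDerivAt x (R.field (x t) (C.um R (x t) t)) t) :
    HasDerivAt (fun s => C.sigmaM R (x s) (x s) s)
      (-(R.EDm (x t) *ᵥ ((R.Mm (x t).qm)⁻¹ *ᵥ C.sigmaM R (x t) (x t) t))
        - C.metm 0 t *ᵥ C.errQm R (x t) (x t) t
        - C.Kmd *ᵥ ((R.Mm (x t).qm)⁻¹ *ᵥ C.sigmaM R (x t) (x t) t)) t := by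
  have h1 := Robot.hasDerivAt_along hC.smooth_pmr (fun _ _ => hC.pmr_dropMotorMomentum ht _ _) hx
  have h2 : HasDerivAt (fun s => (x s).pm) (R.field (x t) (C.um R (x t) t)).pm t :=
    hx.snd.snd.snd
  refine (h2.sub h1).congr_deriv ?_
  have h3 : (R.field (x t) (C.um R (x t) t)).pm =
      -(grad R.Pm (x t).qm + R.K *ᵥ ((x t).qm - (x t).ql))
      - R.EDm (x t) *ᵥ ((R.Mm (x t).qm)⁻¹ *ᵥ (x t).pm) + C.umv R (x t) (x t) t := by
    rw [R.field_eq_virtualField, R.virtualField_eq]; rfl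
  have h5 : (x t).pm = C.sigmaM R (x t) (x t) t + C.pmr R (x t) (x t) t :=
    (sub_add_cancel _ _).symm
  rw [h3, Design.umv, lineIntegral_of_const (hC.metm_const t ht)]
  conv_lhs => rw [h5]
  simp only [Matrix.mulVec_add]
  abel

/-- Along the closed loop the coupling terms of the storage function cancel; what remains is the
contraction of the position errors and the dissipation of the momentum errors. -/
theorem hasDerivAt_storage {x : ℝ → State n} {t b : ℝ} (ht : 0 < t)
    (hx : HasDerivAt x (R.field (x t) (C.um R (x t) t)) t)
    (hb : ∀ θ ∈ Icc (0 : ℝ) 1,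
      b ≤ C.rate R (θ • C.errQl (x t) t) (θ • C.errQm R (x t) (x t) t) (x t) t) :
    ∃ W', HasDerivAt (fun s => C.storage R (x s) s) W' t ∧ W' ≤ -b * C.storage R (x t) t := by
  have hel := hC.hasDerivAt_errQl hx
  have hem := hC.hasDerivAt_errQm hx
  have hsl := hC.hasDerivAt_sigmaL ht.le hx
  have hsm := hC.hasDerivAt_sigmaM ht.le hx
  have hql : HasDerivAt (fun s => (x s).ql) ((R.Ml (x t).ql)⁻¹ *ᵥ (x t).pl) t := by
    have h : HasDerivAt (fun s => (x s).ql) (R.field (x t) (C.um R (x t) t)).ql t := hx.fst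
    rw [R.field_eq_virtualField, R.virtualField_eq] at h
    exact h
  have hqm : HasDerivAt (fun s => (x s).qm) ((R.Mm (x t).qm)⁻¹ *ᵥ (x t).pm) t := by
    have h : HasDerivAt (fun s => (x s).qm) (R.field (x t) (C.um R (x t) t)).qm t := hx.snd.fst
    rw [R.field_eq_virtualField, R.virtualField_eq] at h
    exact h
  have d1 := hasDerivAt_metric_energy hC.metl_smooth hC.metl_const ht (hC.metl_symm 0 ht.le) hel
  have d2 := hasDerivAt_metric_energy hC.metm_smooth hC.metm_const ht (hC.metm_symm 0 ht.le) hem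
  have d3 := hasDerivAt_kinetic R.Ml_smooth R.Ml_posDef hql hsl
  have d4 := hasDerivAt_kinetic R.Mm_smooth R.Mm_posDef hqm hsm
  refine ⟨_, (((d1.add d2).add d3).add d4).const_mul (1 / 2 : ℝ), ?_⟩
  have rl := hC.ray_l ht (e := C.errQl (x t) t) (b := b / 2) fun θ hθ => by
    have h1 := (hb θ hθ).trans (mul_le_mul_of_nonneg_left
      ((min_le_left _ _).trans (min_le_left _ _)) zero_le_two)
    linarith
  have rm := hC.ray_m ht (e := C.errQm R (x t) (x t) t) (b := b / 2) fun θ hθ => by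
    have h1 := (hb θ hθ).trans (mul_le_mul_of_nonneg_left
      ((min_le_left _ _).trans (min_le_right _ _)) zero_le_two)
    linarith
  have rs : b / 2 ≤ C.momentumRate R (x t) := by
    have h1 := (hb 0 ⟨le_rfl, zero_le_one⟩).trans (mul_le_mul_of_nonneg_left
      (min_le_right _ _) zero_le_two)
    linarith
  rw [Design.storage, hC.vbar_eq _ _ ht.le, hC.metl_const t ht.le (C.errQl (x t) t),
    hC.metm_const t ht.le (C.errQm R (x t) (x t) t)]
  set el := C.errQl (x t) t
  set em := C.errQm R (x t) (x t) t
  set sl := C.sigmaL R (x t) (x t) t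
  set sm := C.sigmaM R (x t) (x t) t
  set vl := (R.Ml (x t).ql)⁻¹ *ᵥ sl with hvl
  set vm := (R.Mm (x t).qm)⁻¹ *ᵥ sm with hvm
  have hsl' : sl = R.Ml (x t).ql *ᵥ vl := (mulVec_inv_mulVec (R.Ml_posDef _) sl).symm
  have hsm' : sm = R.Mm (x t).qm *ᵥ vm := (mulVec_inv_mulVec (R.Mm_posDef _) sm).symm
  have hmom := hC.momentumRate_mul_le (x t) vl vm
  rw [← hsl', ← hsm'] at hmom
  have hkin : 0 ≤ vl ⬝ᵥ sl + vm ⬝ᵥ sm := by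
    have h1 := (R.Ml_posDef (x t).ql).posSemidef.dotProduct_mulVec_nonneg vl
    have h2 := (R.Mm_posDef (x t).qm).posSemidef.dotProduct_mulVec_nonneg vm
    rw [star_trivial, ← hsl'] at h1
    rw [star_trivial, ← hsm'] at h2
    exact add_nonneg h1 h2
  have hrs := mul_le_mul_of_nonneg_right rs hkin
  have hwl := workless_quadratic (fun q => R.Ml_symm q) (x t).ql (x t).pl vl
  have hwm := workless_quadratic (fun q => R.Mm_symm q) (x t).qm (x t).pm vm
  -- the coupling velocity cancels the spring torque
  have hcouple : (C.metm 0 t *ᵥ em) ⬝ᵥ ((C.metm 0 t)⁻¹ *ᵥ (R.K *ᵥ vl)) = vl ⬝ᵥ R.K *ᵥ em := by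
    rw [dotProduct_comm, dotProduct_mulVec_symm (hC.metm_symm 0 ht.le),
      mulVec_inv_mulVec (hC.metm_posDef 0 t ht.le), dotProduct_mulVec_symm R.K_symm]
  simp only [dotProduct_sub, dotProduct_add, dotProduct_neg, Robot.EDl, Robot.EDm,
    Matrix.add_mulVec, hcouple]
  rw [dotProduct_comm (C.metl 0 t *ᵥ el) vl, dotProduct_comm (C.metm 0 t *ᵥ em) vm,
    dotProduct_comm sl vl, dotProduct_comm sm vm]
  linarith

theorem contDiff_storage : ContDiff ℝ ∞ fun y : State n × ℝ => C.storage R y.1 y.2 := by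
  have hin : ContDiff ℝ ∞ fun y : State n × ℝ => ((y.1, y.1, y.2) : State n × State n × ℝ) :=
    contDiff_fst.prodMk (contDiff_fst.prodMk contDiff_snd)
  have hel : ContDiff ℝ ∞ fun y : State n × ℝ => C.errQl y.1 y.2 := hC.smooth_errQl.comp hin
  have hem : ContDiff ℝ ∞ fun y : State n × ℝ => C.errQm R y.1 y.1 y.2 :=
    hC.smooth_errQm.comp hin
  have hsl : ContDiff ℝ ∞ fun y : State n × ℝ => C.sigmaL R y.1 y.1 y.2 :=
    hC.smooth_sigmaL.comp hin
  have hsm : ContDiff ℝ ∞ fun y : State n × ℝ => C.sigmaM R y.1 y.1 y.2 :=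
    hC.smooth_sigmaM.comp hin
  have h1 := contDiff_dotProduct hel (contDiff_mulVec
    (fun i j => (hC.metl_smooth i j).comp (hel.prodMk contDiff_snd)) hel)
  have h2 := contDiff_dotProduct hem (contDiff_mulVec
    (fun i j => (hC.metm_smooth i j).comp (hem.prodMk contDiff_snd)) hem)
  have h3 := contDiff_dotProduct hsl (contDiff_mulVec
    (fun i j => (R.contDiff_Ml_inv i j).comp (contDiff_ql contDiff_fst)) hsl)
  have h4 := contDiff_dotProduct hsm (contDiff_mulVec
    (fun i j => (R.contDiff_Mm_inv i j).comp (contDiff_qm contDiff_fst)) hsm)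
  exact contDiff_const.mul (((h1.add h2).add h3).add h4)

theorem continuousOn_storage_comp {x : ℝ → State n} {s : Set ℝ} (hx : ContinuousOn x s) :
    ContinuousOn (fun t => C.storage R (x t) t) s := by
  have hin : ContinuousOn (fun t => ((x t, t) : State n × ℝ)) s := hx.prodMk continuousOn_id
  have h : Continuous fun y : State n × ℝ => C.storage R y.1 y.2 := hC.contDiff_storage.continuous
  have h' := h.comp_continuousOn hin
  simpa only [Function.comp_def] using h'

theorem storage_parts_nonneg (x : State n) {t : ℝ} (ht : 0 ≤ t) :
    0 ≤ C.errQl x t ⬝ᵥ C.metl (C.errQl x t) t *ᵥ C.errQl x t ∧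
    0 ≤ C.errQm R x x t ⬝ᵥ C.metm (C.errQm R x x t) t *ᵥ C.errQm R x x t ∧
    0 ≤ C.sigmaL R x x t ⬝ᵥ (R.Ml x.ql)⁻¹ *ᵥ C.sigmaL R x x t ∧
    0 ≤ C.sigmaM R x x t ⬝ᵥ (R.Mm x.qm)⁻¹ *ᵥ C.sigmaM R x x t := by
  have h : ∀ {A : Matrix (Fin n) (Fin n) ℝ}, A.PosDef → ∀ v : V n, 0 ≤ v ⬝ᵥ A *ᵥ v :=
    fun hA v => by simpa using hA.posSemidef.dotProduct_mulVec_nonneg v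
  exact ⟨h (hC.metl_posDef _ t ht) _, h (hC.metm_posDef _ t ht) _, h (R.Ml_posDef _).inv _,
    h (R.Mm_posDef _).inv _⟩

/-- Grönwall's argument: `W exp (∫ b)` does not increase. The derivative is needed only inside the
time interval, where the one-sided derivative of a solution is a derivative. -/
theorem storage_le {t₀ T : ℝ} {x : ℝ → State n} {b : ℝ → ℝ} (h0 : 0 ≤ t₀) (hT : t₀ ≤ T)
    (hx : C.IsClosedLoopSolution R x (Icc t₀ T)) (hbc : ContinuousOn b (Icc t₀ T))
    (hb : ∀ s ∈ Icc t₀ T, ∀ θ ∈ Icc (0 : ℝ) 1,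
      b s ≤ C.rate R (θ • C.errQl (x s) s) (θ • C.errQm R (x s) (x s) s) (x s) s) :
    C.storage R (x T) T ≤ C.storage R (x t₀) t₀ * Real.exp (-∫ s in t₀..T, b s) := by
  have hxc : ContinuousOn x (Icc t₀ T) := fun t ht => (hx t ht).continuousWithinAt
  have hBc : ContinuousOn (fun t => ∫ s in t₀..t, b s) (Icc t₀ T) := by
    have h := intervalIntegral.continuousOn_primitive_interval (μ := volume)
      (hbc.integrableOn_Icc.mono_set (uIcc_of_le hT).le)
    rwa [uIcc_of_le hT] at h
  have hanti : AntitoneOn (fun t => C.storage R (x t) t * Real.exp (∫ s in t₀..t, b s))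
      (Icc t₀ T) := by
    have hder : ∀ t ∈ Ioo t₀ T, ∃ D ≤ 0,
        HasDerivAt (fun t => C.storage R (x t) t * Real.exp (∫ s in t₀..t, b s)) D t := by
      intro t ht
      have hnhds : Icc t₀ T ∈ 𝓝 t := Icc_mem_nhds ht.1 ht.2
      have hx' := (hx t ⟨ht.1.le, ht.2.le⟩).hasDerivAt hnhds
      obtain ⟨W', hW, hle⟩ := hC.hasDerivAt_storage (h0.trans_lt ht.1) hx'
        (hb t ⟨ht.1.le, ht.2.le⟩)
      have hB : HasDerivAt (fun t => ∫ s in t₀..t, b s) (b t) t := by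
        refine intervalIntegral.integral_hasDerivAt_right ?_ ?_ (hbc.continuousAt hnhds)
        · exact (hbc.mono (by
            rw [uIcc_of_le ht.1.le]; exact Icc_subset_Icc_right ht.2.le)).intervalIntegrable
        · exact (hbc.mono Ioo_subset_Icc_self).stronglyMeasurableAtFilter isOpen_Ioo t ht
      refine ⟨_, ?_, hW.mul hB.exp⟩
      have h1 := mul_le_mul_of_nonneg_right hle (Real.exp_pos (∫ s in t₀..t, b s)).le
      linarith
    refine antitoneOn_of_deriv_nonpos (convex_Icc _ _)
      ((hC.continuousOn_storage_comp hxc).mul hBc.rexp) ?_ ?_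
    · rw [interior_Icc]
      intro t ht
      obtain ⟨D, -, hD⟩ := hder t ht
      exact hD.differentiableAt.differentiableWithinAt
    · rw [interior_Icc]
      intro t ht
      obtain ⟨D, hD0, hD⟩ := hder t ht
      rwa [hD.deriv]
  have h1 := hanti (left_mem_Icc.2 hT) (right_mem_Icc.2 hT) hT
  simp only [intervalIntegral.integral_same, Real.exp_zero, mul_one] at h1
  rw [Real.exp_neg, ← div_eq_mul_inv]
  exact (le_div_iff₀ (Real.exp_pos _)).2 h1

theorem link_error_le {c : ℝ}
    (hmet : ∀ z t, 0 ≤ t → ∀ v : V n, c * (v ⬝ᵥ v) ≤ v ⬝ᵥ C.metl z t *ᵥ v)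
    {t₀ T : ℝ} {x : ℝ → State n} {b : ℝ → ℝ} (h0 : 0 ≤ t₀) (hT : t₀ ≤ T)
    (hx : C.IsClosedLoopSolution R x (Icc t₀ T)) (hbc : ContinuousOn b (Icc t₀ T))
    (hb : ∀ s ∈ Icc t₀ T, ∀ θ ∈ Icc (0 : ℝ) 1,
      b s ≤ C.rate R (θ • C.errQl (x s) s) (θ • C.errQm R (x s) (x s) s) (x s) s) :
    c * (((x T).ql - C.qd T) ⬝ᵥ ((x T).ql - C.qd T)) ≤
      2 * C.storage R (x t₀) t₀ * Real.exp (-∫ s in t₀..T, b s) := by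
  have h1 := hC.storage_le h0 hT hx hbc hb
  have h2 := hmet (C.errQl (x T) T) T (h0.trans hT) (C.errQl (x T) T)
  obtain ⟨-, p2, p3, p4⟩ := hC.storage_parts_nonneg (x T) (h0.trans hT)
  change c * (C.errQl (x T) T ⬝ᵥ C.errQl (x T) T) ≤ _
  have h3 : C.errQl (x T) T ⬝ᵥ C.metl (C.errQl (x T) T) T *ᵥ C.errQl (x T) T ≤
      2 * C.storage R (x T) T := by
    rw [Design.storage]
    linarith
  linarith

theorem rate_nonneg (zl zm : V n) (x : State n) {t : ℝ} (ht : 0 ≤ t) :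
    0 ≤ C.rate R zl zm x t := by
  obtain ⟨ε, hε, hl⟩ := hC.βl_pos
  obtain ⟨ε', hε', hm⟩ := hC.βm_pos
  exact mul_nonneg zero_le_two (le_min (le_min (hε.le.trans (hl zl t ht))
    (hε'.le.trans (hm zm t ht))) (hC.momentumRate_nonneg x))

theorem storage_le_initial {t₀ T : ℝ} {x : ℝ → State n} (h0 : 0 ≤ t₀) (hT : t₀ ≤ T)
    (hx : C.IsClosedLoopSolution R x (Icc t₀ T)) :
    C.storage R (x T) T ≤ C.storage R (x t₀) t₀ := by
  have h := hC.storage_le (b := fun _ => 0) h0 hT hx continuousOn_const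
    fun s hs θ _ => hC.rate_nonneg _ _ _ (h0.trans hs.1)
  simpa using h

end Design.Admissible

/-! ### Global solutions from a priori bounds -/

section ODE

variable {E : Type*} [NormedAddCommGroup E] [NormedSpace ℝ E] [FiniteDimensional ℝ E]
  {f : ℝ → E → E}

theorem exists_lipschitzOnWith_closedBall (hf : ContDiff ℝ 1 fun y : ℝ × E => f y.1 y.2)
    (a b : ℝ) (x : E) (r : ℝ) :
    ∃ K : NNReal, ∀ t ∈ Icc a b, LipschitzOnWith K (f t) (closedBall x r) := by
  have : ProperSpace E := FiniteDimensional.proper ℝ E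
  have hc : IsCompact (Icc a b ×ˢ closedBall x r) := isCompact_Icc.prod (isCompact_closedBall x r)
  obtain ⟨K, hK⟩ := hc.exists_bound_of_continuousOn (hf.continuous_fderiv one_ne_zero).continuousOn
  refine ⟨K.toNNReal, fun t ht => ?_⟩
  have hd : ∀ y ∈ closedBall x r, HasFDerivWithinAt (f t)
      ((fderiv ℝ (fun y : ℝ × E => f y.1 y.2) (t, y)).comp (ContinuousLinearMap.inr ℝ ℝ E))
      (closedBall x r) y := by
    intro y _
    have h1 := (hf.differentiable one_ne_zero (t, y)).hasFDerivAt
    exact (h1.comp y (hasFDerivAt_prodMk_right t y)).hasFDerivWithinAt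
  refine (convex_closedBall x r).lipschitzOnWith_of_nnnorm_hasFDerivWithin_le hd fun y hy => ?_
  rw [← NNReal.coe_le_coe, coe_nnnorm]
  refine (ContinuousLinearMap.opNorm_comp_le _ _).trans ?_
  refine le_trans ?_ ((hK (t, y) ⟨ht, hy⟩).trans (Real.le_coe_toNNReal K))
  exact mul_le_of_le_one_right (norm_nonneg _) (ContinuousLinearMap.norm_inr_le_one ℝ ℝ E)

/-- With a bound uniform in space, the Picard–Lindelöf theorem applies on the whole time interval:
the ball can be chosen so large that a solution cannot leave it. -/
theorem exists_solution_of_bounded (hf : ContDiff ℝ 1 fun y : ℝ × E => f y.1 y.2) {t₀ T B : ℝ}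
    (hT : t₀ ≤ T) (hB : ∀ t ∈ Icc t₀ T, ∀ x, ‖f t x‖ ≤ B) (x₀ : E) :
    ∃ y : ℝ → E, y t₀ = x₀ ∧
      ∀ t ∈ Icc t₀ T, HasDerivWithinAt y (f t (y t)) (Icc t₀ T) t := by
  have : CompleteSpace E := FiniteDimensional.complete ℝ E
  obtain ⟨K, hK⟩ := exists_lipschitzOnWith_closedBall hf t₀ T x₀
    (B.toNNReal * (T - t₀).toNNReal : NNReal)
  have hPL : IsPicardLindelof f (tmin := t₀) (tmax := T) ⟨t₀, left_mem_Icc.2 hT⟩ x₀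
      (B.toNNReal * (T - t₀).toNNReal) 0 B.toNNReal K := by
    refine ⟨hK, fun x _ => ?_, fun t ht x _ => (hB t ht x).trans (Real.le_coe_toNNReal B), ?_⟩
    · have hin : Continuous fun t : ℝ => ((t, x) : ℝ × E) := by fun_prop
      exact (hf.continuous.comp hin).continuousOn
    · simp [Real.coe_toNNReal _ (sub_nonneg.2 hT), hT]
  exact hPL.exists_eq_forall_mem_Icc_hasDerivWithinAt₀

/-- A solution on a compact interval exists if all solutions starting at `x₀` are bounded
a priori: the vector field is cut off outside a ball that the solutions cannot leave. -/
theorem exists_solution_Icc (hf : ContDiff ℝ 1 fun y : ℝ × E => f y.1 y.2) {t₀ T r : ℝ}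
    (hT : t₀ ≤ T) (x₀ : E)
    (hr : ∀ S ∈ Icc t₀ T, ∀ y : ℝ → E, y t₀ = x₀ →
      (∀ t ∈ Icc t₀ S, HasDerivWithinAt y (f t (y t)) (Icc t₀ S) t) → ‖y S‖ ≤ r) :
    ∃ y : ℝ → E, y t₀ = x₀ ∧
      ∀ t ∈ Icc t₀ T, HasDerivWithinAt y (f t (y t)) (Icc t₀ T) t := by
  have : ProperSpace E := FiniteDimensional.proper ℝ E
  set ρ := max r 0 + 1 with hρ
  have hrρ : r < ρ := by linarith [le_max_left r 0]
  have hρ0 : 0 < ρ := by linarith [le_max_right r 0]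
  let χ : ContDiffBump (0 : E) := ⟨ρ, ρ + 1, hρ0, by linarith⟩
  have hc : IsCompact (Icc t₀ T ×ˢ closedBall (0 : E) (ρ + 1)) :=
    isCompact_Icc.prod (isCompact_closedBall _ _)
  obtain ⟨B, hB⟩ := hc.exists_bound_of_continuousOn hf.continuous.continuousOn
  have hg : ContDiff ℝ 1 fun y : ℝ × E => χ y.2 • f y.1 y.2 :=
    (χ.contDiff.comp contDiff_snd).smul hf
  have hgB : ∀ t ∈ Icc t₀ T, ∀ x, ‖χ x • f t x‖ ≤ max B 0 := by
    intro t ht x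
    by_cases hx : x ∈ closedBall (0 : E) (ρ + 1)
    · rw [norm_smul, Real.norm_of_nonneg χ.nonneg]
      exact (mul_le_of_le_one_left (norm_nonneg _) χ.le_one).trans
        ((hB (t, x) ⟨ht, hx⟩).trans (le_max_left _ _))
    · rw [χ.zero_of_le_dist (not_le.1 hx).le, zero_smul, norm_zero]
      exact le_max_right _ _
  obtain ⟨y, hy0, hy⟩ := exists_solution_of_bounded (f := fun t x => χ x • f t x) hg hT hgB x₀
  have hχ : ∀ x : E, ‖x‖ ≤ ρ → χ x = 1 := fun x hx =>
    χ.one_of_mem_closedBall (by simpa [χ] using hx)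
  have hyc : ContinuousOn (fun t => ‖y t‖) (Icc t₀ T) :=
    ContinuousOn.norm fun t ht => (hy t ht).continuousWithinAt
  -- as long as `y` stays in the ball of radius `ρ`, it solves the original equation
  have hsol : ∀ S ∈ Icc t₀ T, (∀ t ∈ Icc t₀ S, ‖y t‖ ≤ ρ) →
      ∀ t ∈ Icc t₀ S, HasDerivWithinAt y (f t (y t)) (Icc t₀ S) t := by
    intro S hS hyS t ht
    have h1 := (hy t ⟨ht.1, ht.2.trans hS.2⟩).mono (Icc_subset_Icc_right hS.2)
    rwa [hχ _ (hyS t ht), one_smul] at h1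
  have hlt : ∀ t ∈ Icc t₀ T, ‖y t‖ < ρ := by
    by_contra! hne
    have hcl : IsCompact {t ∈ Icc t₀ T | ρ ≤ ‖y t‖} :=
      isCompact_Icc.of_isClosed_subset
        (hyc.preimage_isClosed_of_isClosed isClosed_Icc isClosed_Ici) fun t ht => ht.1
    obtain ⟨τ, ⟨hτ, hρτ⟩, hleast⟩ := hcl.exists_isLeast hne
    have h0 : ‖y t₀‖ ≤ r := hr t₀ ⟨le_rfl, hT⟩ y hy0 fun t ht => by
      rw [Icc_self] at ht ⊢
      rw [mem_singleton_iff.1 ht]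
      exact HasFDerivWithinAt.of_subsingleton subsingleton_singleton
    -- `τ` is the first time at which `y` reaches the sphere of radius `ρ`
    obtain ⟨u, hu, hyu⟩ := intermediate_value_Icc hτ.1 (hyc.mono (Icc_subset_Icc_right hτ.2))
      ⟨h0.trans hrρ.le, hρτ⟩
    have huτ : u = τ := le_antisymm hu.2 (hleast ⟨⟨hu.1, hu.2.trans hτ.2⟩, hyu.ge⟩)
    have hle : ∀ t ∈ Icc t₀ τ, ‖y t‖ ≤ ρ := by
      intro t ht
      by_contra! h
      have h1 := hleast ⟨⟨ht.1, ht.2.trans hτ.2⟩, h.le⟩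
      rw [le_antisymm ht.2 h1, ← huτ] at h
      exact h.ne' hyu
    have h1 := hr τ hτ y hy0 (hsol τ hτ hle)
    linarith
  exact ⟨y, hy0, hsol T ⟨hT, le_rfl⟩ fun t ht => (hlt t ht).le⟩

theorem solution_unique (hf : ContDiff ℝ 1 fun y : ℝ × E => f y.1 y.2) {t₀ S : ℝ}
    {y z : ℝ → E} (h0 : y t₀ = z t₀)
    (hy : ∀ t ∈ Icc t₀ S, HasDerivWithinAt y (f t (y t)) (Icc t₀ S) t)
    (hz : ∀ t ∈ Icc t₀ S, HasDerivWithinAt z (f t (z t)) (Icc t₀ S) t) :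
    EqOn y z (Icc t₀ S) := by
  have hyc : ContinuousOn y (Icc t₀ S) := fun t ht => (hy t ht).continuousWithinAt
  have hzc : ContinuousOn z (Icc t₀ S) := fun t ht => (hz t ht).continuousWithinAt
  obtain ⟨B₁, h₁⟩ := isCompact_Icc.exists_bound_of_continuousOn hyc
  obtain ⟨B₂, h₂⟩ := isCompact_Icc.exists_bound_of_continuousOn hzc
  obtain ⟨K, hK⟩ := exists_lipschitzOnWith_closedBall hf t₀ S 0 (max B₁ B₂)
  refine ODE_solution_unique_of_mem_Icc_right (v := f) (s := fun _ => closedBall 0 (max B₁ B₂))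
    (fun t ht => hK t ⟨ht.1, ht.2.le⟩) hyc
    (fun t ht => (hy t ⟨ht.1, ht.2.le⟩).mono_of_mem_nhdsWithin (Icc_mem_nhdsGE_of_mem ht))
    (fun t ht => ?_) hzc
    (fun t ht => (hz t ⟨ht.1, ht.2.le⟩).mono_of_mem_nhdsWithin (Icc_mem_nhdsGE_of_mem ht))
    (fun t ht => ?_) h0
  · exact mem_closedBall_zero_iff.2 ((h₁ t ⟨ht.1, ht.2.le⟩).trans (le_max_left _ _))
  · exact mem_closedBall_zero_iff.2 ((h₂ t ⟨ht.1, ht.2.le⟩).trans (le_max_right _ _))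

/-- Global existence: the solutions on the intervals `[t₀, t₀ + N]` are restrictions of one
another. -/
theorem exists_solution_Ici (hf : ContDiff ℝ 1 fun y : ℝ × E => f y.1 y.2) (t₀ : ℝ) (x₀ : E)
    (hr : ∀ T, t₀ ≤ T → ∃ r, ∀ S ∈ Icc t₀ T, ∀ y : ℝ → E, y t₀ = x₀ →
      (∀ t ∈ Icc t₀ S, HasDerivWithinAt y (f t (y t)) (Icc t₀ S) t) → ‖y S‖ ≤ r) :
    ∃ y : ℝ → E, y t₀ = x₀ ∧
      ∀ t ∈ Ici t₀, HasDerivWithinAt y (f t (y t)) (Ici t₀) t := by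
  have hex : ∀ N : ℕ, ∃ y : ℝ → E, y t₀ = x₀ ∧ ∀ t ∈ Icc t₀ (t₀ + N),
      HasDerivWithinAt y (f t (y t)) (Icc t₀ (t₀ + N)) t := by
    intro N
    have hT : t₀ ≤ t₀ + N := by linarith [N.cast_nonneg (α := ℝ)]
    obtain ⟨r, h⟩ := hr _ hT
    exact exists_solution_Icc hf hT x₀ h
  choose y hy0 hy using hex
  have huniq : ∀ N N' : ℕ, N ≤ N' → EqOn (y N) (y N') (Icc t₀ (t₀ + N)) := by
    intro N N' hN
    have hsub : Icc t₀ (t₀ + N) ⊆ Icc t₀ (t₀ + N') := Icc_subset_Icc_right (by gcongr)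
    exact solution_unique hf ((hy0 N).trans (hy0 N').symm) (hy N)
      fun t ht => (hy N' t (hsub ht)).mono hsub
  let k : ℝ → ℕ := fun t => ⌈t - t₀⌉₊ + 1
  have hk : ∀ t, t < t₀ + k t := by
    intro t
    have h1 := Nat.le_ceil (t - t₀)
    simp only [k, Nat.cast_add, Nat.cast_one]
    linarith
  have heq : ∀ (N : ℕ), ∀ t ∈ Icc t₀ (t₀ + N), y (k t) t = y N t := by
    intro N t ht
    rcases le_total (k t) N with h | h
    · exact huniq _ _ h ⟨ht.1, (hk t).le⟩
    · exact (huniq _ _ h ht).symm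
  refine ⟨fun t => y (k t) t, hy0 _, fun t ht => ?_⟩
  have hmem : t ∈ Icc t₀ (t₀ + k t) := ⟨ht, (hk t).le⟩
  have h1 : HasDerivWithinAt (fun t => y (k t) t) (f t (y (k t) t)) (Icc t₀ (t₀ + k t)) t :=
    (hy (k t) t hmem).congr (heq (k t)) rfl
  refine h1.mono_of_mem_nhdsWithin ?_
  rw [← Ici_inter_Iic]
  exact inter_mem_nhdsWithin _ (Iic_mem_nhds (hk t))

end ODE

/-! ### Boundedness of the states with bounded storage -/

/-- A continuous family of positive definite forms is coercive uniformly on compact sets. -/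
theorem exists_norm_le_of_quadratic_le {X : Type*} [TopologicalSpace X] {n : ℕ}
    {A : X → Matrix (Fin n) (Fin n) ℝ} {S : Set X} (hS : IsCompact S)
    (hA : ∀ i j, ContinuousOn (fun y => A y i j) S) (hpos : ∀ y ∈ S, (A y).PosDef) (w : ℝ) :
    ∃ r, ∀ y ∈ S, ∀ v : V n, v ⬝ᵥ A y *ᵥ v ≤ w → ‖v‖ ≤ r := by
  have hp : ∀ y ∈ S, ∀ u : V n, u ≠ 0 → 0 < u ⬝ᵥ A y *ᵥ u := fun y hy u hu => by
    simpa using (hpos y hy).dotProduct_mulVec_pos hu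
  have hcont : ContinuousOn (fun z : X × V n => (z.2 ⬝ᵥ A z.1 *ᵥ z.2)⁻¹) (S ×ˢ sphere 0 1) := by
    refine ContinuousOn.inv₀ ?_ fun z hz => (hp z.1 hz.1 z.2 ?_).ne'
    · simp only [dotProduct, Matrix.mulVec]
      refine continuousOn_finsetSum _ fun i _ => ContinuousOn.mul (by fun_prop) ?_
      refine continuousOn_finsetSum _ fun j _ => ContinuousOn.mul ?_ (by fun_prop)
      exact (hA i j).comp continuousOn_fst fun z hz => hz.1
    · rintro h
      have := hz.2
      rw [h] at this
      simp at this
  obtain ⟨B, hB⟩ := (hS.prod (isCompact_sphere (0 : V n) 1)).exists_bound_of_continuousOn hcont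
  refine ⟨1 + |B| * |w|, fun y hy v hv => ?_⟩
  by_cases hv0 : v = 0
  · rw [hv0, norm_zero]
    positivity
  have hn : 0 < ‖v‖ := norm_pos_iff.2 hv0
  set u : V n := ‖v‖⁻¹ • v with hu
  have hu1 : ‖u‖ = 1 := by
    rw [hu, norm_smul, norm_inv, norm_norm, inv_mul_cancel₀ hn.ne']
  have hu0 : u ≠ 0 := by
    intro h
    rw [h, norm_zero] at hu1
    exact zero_ne_one hu1
  have hvu : v ⬝ᵥ A y *ᵥ v = ‖v‖ ^ 2 * (u ⬝ᵥ A y *ᵥ u) := by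
    have : v = ‖v‖ • u := by rw [hu, smul_smul, mul_inv_cancel₀ hn.ne', one_smul]
    conv_lhs => rw [this]
    simp only [Matrix.mulVec_smul, dotProduct_smul, smul_dotProduct, smul_eq_mul]
    ring
  have hpu := hp y hy u hu0
  have hBu : (u ⬝ᵥ A y *ᵥ u)⁻¹ ≤ |B| :=
    (le_abs_self _).trans ((hB (y, u) ⟨hy, by simpa using hu1⟩).trans (le_abs_self B))
  have hsq : ‖v‖ ^ 2 ≤ |B| * |w| := by
    calc ‖v‖ ^ 2 = (u ⬝ᵥ A y *ᵥ u)⁻¹ * (v ⬝ᵥ A y *ᵥ v) := by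
          rw [hvu]; field_simp
      _ ≤ (u ⬝ᵥ A y *ᵥ u)⁻¹ * |w| := by
          gcongr
          exact hv.trans (le_abs_self w)
      _ ≤ |B| * |w| := by gcongr
  nlinarith [sq_nonneg (‖v‖ - 1)]

theorem SmoothIn.exists_bound {n : ℕ} {G : Type} [NormedAddCommGroup G] [NormedSpace ℝ G]
    {F : State n → State n → ℝ → G} (hF : SmoothIn F) (ρ a b : ℝ) :
    ∃ B, ∀ x : State n, ‖x‖ ≤ ρ → ∀ t ∈ Icc a b, ‖F x x t‖ ≤ B := by
  have hin : Continuous fun y : State n × ℝ => ((y.1, y.1, y.2) : State n × State n × ℝ) := by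
    fun_prop
  have hc : IsCompact (closedBall (0 : State n) ρ ×ˢ Icc a b) :=
    (isCompact_closedBall _ _).prod isCompact_Icc
  obtain ⟨B, hB⟩ := hc.exists_bound_of_continuousOn
    ((ContDiff.continuous hF).comp hin).continuousOn
  exact ⟨B, fun x hx t ht => hB (x, t) ⟨mem_closedBall_zero_iff.2 hx, ht⟩⟩

theorem norm_state_le {n : ℕ} {x : State n} {r : ℝ} (h1 : ‖x.ql‖ ≤ r) (h2 : ‖x.qm‖ ≤ r)
    (h3 : ‖x.pl‖ ≤ r) (h4 : ‖x.pm‖ ≤ r) : ‖x‖ ≤ r :=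
  norm_prod_le_iff.2 ⟨h1, norm_prod_le_iff.2 ⟨h2, norm_prod_le_iff.2 ⟨h3, h4⟩⟩⟩

namespace Design.Admissible

variable {n : ℕ} {R : Robot n} {C : Design n} (hC : C.Admissible R)

include hC

/-- On compact time intervals the storage function controls the state. Its four parts bound, in
this order, `q_ℓ`, then `p_ℓ`, then `q_m` and then `p_m`: each reference depends only on variables
that have been bounded before. -/
theorem exists_norm_le_of_storage_le {t₀ T : ℝ} (h0 : 0 ≤ t₀) (w : ℝ) :
    ∃ r, ∀ t ∈ Icc t₀ T, ∀ x, C.storage R x t ≤ w → ‖x‖ ≤ r := by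
  have hslice : ∀ {A : V n → ℝ → Matrix (Fin n) (Fin n) ℝ},
      (∀ i j, ContDiff ℝ ∞ fun y : V n × ℝ => A y.1 y.2 i j) → ∀ i j,
      ContinuousOn (fun t => A 0 t i j) (Icc t₀ T) := fun hA i j =>
    ((hA i j).continuous.comp
      (by fun_prop : Continuous fun t : ℝ => ((0, t) : V n × ℝ))).continuousOn
  obtain ⟨r₁, hr₁⟩ := exists_norm_le_of_quadratic_le (isCompact_Icc (a := t₀) (b := T))
    (hslice hC.metl_smooth) (fun t ht => hC.metl_posDef 0 t (h0.trans ht.1)) (2 * w)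
  obtain ⟨r₂, hr₂⟩ := exists_norm_le_of_quadratic_le (isCompact_Icc (a := t₀) (b := T))
    (hslice hC.metm_smooth) (fun t ht => hC.metm_posDef 0 t (h0.trans ht.1)) (2 * w)
  obtain ⟨b₁, hb₁⟩ := (isCompact_Icc (a := t₀) (b := T)).exists_bound_of_continuousOn
    hC.qd_smooth.continuous.continuousOn
  obtain ⟨r₃, hr₃⟩ := exists_norm_le_of_quadratic_le (isCompact_closedBall (0 : V n) (r₁ + b₁))
    (fun i j => (R.contDiff_Ml_inv i j).continuous.continuousOn)
    (fun q _ => (R.Ml_posDef q).inv) (2 * w)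
  obtain ⟨b₂, hb₂⟩ := hC.smooth_plr.exists_bound (max (r₁ + b₁) 0) t₀ T
  set ρ₂ := max (max (r₁ + b₁) (r₃ + b₂)) 0
  obtain ⟨b₃, hb₃⟩ := hC.smooth_qmd.exists_bound ρ₂ t₀ T
  obtain ⟨r₄, hr₄⟩ := exists_norm_le_of_quadratic_le (isCompact_closedBall (0 : V n) (r₂ + b₃))
    (fun i j => (R.contDiff_Mm_inv i j).continuous.continuousOn)
    (fun q _ => (R.Mm_posDef q).inv) (2 * w)
  obtain ⟨b₄, hb₄⟩ := hC.smooth_pmr.exists_bound (max ρ₂ (r₂ + b₃)) t₀ T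
  refine ⟨max (max ρ₂ (r₂ + b₃)) (r₄ + b₄), fun t ht x hx => ?_⟩
  have ht0 := h0.trans ht.1
  obtain ⟨p₁, p₂, p₃, p₄⟩ := hC.storage_parts_nonneg x ht0
  rw [Design.storage] at hx
  have hel : ‖C.errQl x t‖ ≤ r₁ := by
    refine hr₁ t ht _ ?_
    rw [← hC.metl_const t ht0 (C.errQl x t)]
    linarith
  have hem : ‖C.errQm R x x t‖ ≤ r₂ := by
    refine hr₂ t ht _ ?_
    rw [← hC.metm_const t ht0 (C.errQm R x x t)]
    linarith
  have hql : ‖x.ql‖ ≤ r₁ + b₁ := by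
    have h : x.ql = C.errQl x t + C.qd t := (sub_add_cancel _ _).symm
    rw [h]
    exact (norm_add_le _ _).trans (add_le_add hel (hb₁ t ht))
  have hsl : ‖C.sigmaL R x x t‖ ≤ r₃ :=
    hr₃ x.ql (mem_closedBall_zero_iff.2 hql) _ (by linarith)
  have hpl : ‖x.pl‖ ≤ r₃ + b₂ := by
    have h : x.pl = C.sigmaL R x x t + C.plr R x x t := (sub_add_cancel _ _).symm
    have h2 : ‖C.plr R x x t‖ ≤ b₂ :=
      hb₂ (linkPosition x) (norm_state_le (hql.trans (le_max_left _ _))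
        (norm_zero.trans_le (le_max_right _ _)) (norm_zero.trans_le (le_max_right _ _))
        (norm_zero.trans_le (le_max_right _ _))) t ht
    rw [h]
    exact (norm_add_le _ _).trans (add_le_add hsl h2)
  have hql₂ : ‖x.ql‖ ≤ ρ₂ := hql.trans ((le_max_left _ _).trans (le_max_left _ _))
  have hpl₂ : ‖x.pl‖ ≤ ρ₂ := hpl.trans ((le_max_right _ _).trans (le_max_left _ _))
  have h0₂ : ‖(0 : V n)‖ ≤ ρ₂ := norm_zero.trans_le (le_max_right _ _)
  have hqm : ‖x.qm‖ ≤ r₂ + b₃ := by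
    have h : x.qm = C.errQm R x x t + C.qmd R x x t := (sub_add_cancel _ _).symm
    have h2 : ‖C.qmd R x x t‖ ≤ b₃ := by
      rw [← hC.qmd_linkPart]
      exact hb₃ (linkPart x) (norm_state_le hql₂ h0₂ hpl₂ h0₂) t ht
    rw [h]
    exact (norm_add_le _ _).trans (add_le_add hem h2)
  have hsm : ‖C.sigmaM R x x t‖ ≤ r₄ :=
    hr₄ x.qm (mem_closedBall_zero_iff.2 hqm) _ (by linarith)
  have hpm : ‖x.pm‖ ≤ r₄ + b₄ := by
    have h : x.pm = C.sigmaM R x x t + C.pmr R x x t := (sub_add_cancel _ _).symm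
    have h2 : ‖C.pmr R x x t‖ ≤ b₄ := by
      rw [← hC.pmr_dropMotorMomentum ht0]
      exact hb₄ (dropMotorMomentum x) (norm_state_le (hql₂.trans (le_max_left _ _))
        (hqm.trans (le_max_right _ _)) (hpl₂.trans (le_max_left _ _))
        (h0₂.trans (le_max_left _ _))) t ht
    rw [h]
    exact (norm_add_le _ _).trans (add_le_add hsm h2)
  exact norm_state_le ((hql₂.trans (le_max_left _ _)).trans (le_max_left _ _))
    ((hqm.trans (le_max_right _ _)).trans (le_max_left _ _))
    ((hpl₂.trans (le_max_left _ _)).trans (le_max_left _ _)) (hpm.trans (le_max_right _ _))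

theorem exists_closedLoopSolution {t₀ : ℝ} (h0 : 0 ≤ t₀) (x₀ : State n) :
    ∃ x : ℝ → State n, x t₀ = x₀ ∧ C.IsClosedLoopSolution R x (Ici t₀) := by
  refine exists_solution_Ici (f := fun t x => R.field x (C.um R x t))
    (hC.contDiff_closedLoop.of_le (by exact_mod_cast le_top)) t₀ x₀ fun T _ => ?_
  obtain ⟨r, hr⟩ := hC.exists_norm_le_of_storage_le (T := T) h0 (C.storage R x₀ t₀)
  refine ⟨r, fun S hS y hy0 hy => hr S hS _ ?_⟩
  rw [← hy0]
  exact hC.storage_le_initial h0 hS.1 hy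

end Design.Admissible

end FJR

end

theorem mainTheorem2 {n : ℕ} (hn : 0 < n) (R : FJR.Robot n) (C : FJR.Design n)
    (hC : C.Admissible R) (c : ℝ) (hc : 0 < c)
    (hmet : ∀ z t, 0 ≤ t → ∀ v : FJR.V n, c * (v ⬝ᵥ v) ≤ v ⬝ᵥ C.metl z t *ᵥ v) :
    -- every initial condition starts a solution for all future times
    (∀ t₀ x₀, 0 ≤ t₀ → ∃ x : ℝ → FJR.State n,
      x t₀ = x₀ ∧ C.IsClosedLoopSolution R x (Set.Ici t₀)) ∧
    -- the link position error converges with rate `β`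
    (∀ (t₀ T : ℝ) (x : ℝ → FJR.State n) (b : ℝ → ℝ), 0 ≤ t₀ → t₀ ≤ T →
      C.IsClosedLoopSolution R x (Set.Icc t₀ T) → ContinuousOn b (Set.Icc t₀ T) →
      (∀ s ∈ Set.Icc t₀ T, ∀ θ ∈ Set.Icc (0 : ℝ) 1,
        b s ≤ C.rate R (θ • C.errQl (x s) s) (θ • C.errQm R (x s) (x s) s) (x s) s) →
      c * (((x T).ql - C.qd T) ⬝ᵥ ((x T).ql - C.qd T)) ≤
        2 * C.storage R (x t₀) t₀ * Real.exp (-∫ s in t₀..T, b s)) ∧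
    -- with bounded inertia `β` is bounded below by a positive constant: exponential convergence
    ((∃ m : ℝ, ∀ q v : FJR.V n, v ⬝ᵥ R.Ml q *ᵥ v ≤ m * (v ⬝ᵥ v) ∧
        v ⬝ᵥ R.Mm q *ᵥ v ≤ m * (v ⬝ᵥ v)) →
      ∃ b > 0, (∀ zl zm x t, 0 ≤ t → b ≤ C.rate R zl zm x t) ∧
        ∀ (t₀ : ℝ) (x : ℝ → FJR.State n), 0 ≤ t₀ →
          C.IsClosedLoopSolution R x (Set.Ici t₀) → ∀ t, t₀ ≤ t →
          c * (((x t).ql - C.qd t) ⬝ᵥ ((x t).ql - C.qd t)) ≤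
            2 * C.storage R (x t₀) t₀ * Real.exp (-b * (t - t₀))) := by
  refine ⟨fun t₀ x₀ h0 => hC.exists_closedLoopSolution h0 x₀,
    fun t₀ T x b h0 hT hx hbc hb => hC.link_error_le hmet h0 hT hx hbc hb, ?_⟩
  rintro ⟨m, hm⟩
  obtain ⟨εl, hεl, hl⟩ := hC.βl_pos
  obtain ⟨εm, hεm, hm'⟩ := hC.βm_pos
  obtain ⟨εσ, hεσ, hσ⟩ := hC.exists_le_momentumRate hn hm
  have hrate : ∀ zl zm x t, 0 ≤ t → 2 * min (min εl εm) εσ ≤ C.rate R zl zm x t :=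
    fun zl zm x t ht => mul_le_mul_of_nonneg_left
      (min_le_min (min_le_min (hl zl t ht) (hm' zm t ht)) (hσ x)) zero_le_two
  refine ⟨2 * min (min εl εm) εσ, by positivity, hrate, fun t₀ x h0 hx t ht => ?_⟩
  have h := hC.link_error_le (b := fun _ => 2 * min (min εl εm) εσ) hmet h0 ht
    (fun s hs => (hx s hs.1).mono Set.Icc_subset_Ici_self) continuousOn_const
    fun s hs θ _ => hrate _ _ _ _ (h0.trans hs.1)
  rwa [intervalIntegral.integral_const, smul_eq_mul, mul_comm (t - t₀), ← neg_mul] at h
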